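/- Let $n\ge 1$, $N=2n+1$, and let $\mathbb H^n$ be the Heisenberg group, i.e. $\mathbb R^n\times\mathbb R^n\times\mathbb R$ with the group law $$(x,y,t)\cdot(x',y',t')=\Bigl(x+x',\,y+y',\,t+t'+2\sum_{j=1}^n(x'_jy_j-x_jy'_j)\Bigr),$$ dilations $\delta_\varepsilon(x,y,t)=(\varepsilon x,\varepsilon y,\varepsilon^2t)$ and Lebesgue measure. For $w=(x,y,t)$ write $w_{\mathcal H}=(x,y)\in\mathbb R^{2n}$, with Euclidean norm $|w_{\mathcal H}|$, and $w_N=t$. Let $Z_j=X_j=\partial_{x_j}+2y_j\partial_t$ and $Z_{n+j}=Y_j=\partial_{y_j}-2x_j\partial_t$ for $1\le j\le n$, and $T=\partial_t$. Let $d$ be the Carnot–Carathéodory distance: $d(p,q)$ is the infimum of the lengths of absolutely continuous curves from $p$ to $q$ whose velocity is a.e. of the form $\sum_{i\le 2n}u_iZ_i$, the length being $\int_0^1|u(\tau)|\,d\tau$. For sets, $\mathrm{dist}(A,B)=\inf_{p\in A,\,q\in B}d(p,q)$, which is $+\infty$ if $A$ or $B$ is empty. For $\Omega\subseteq\mathbb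 H^n$ open, the derivatives $Z_iu$ and $Tu$ of $u\in L^1_{\mathrm{loc}}(\Omega)$ are taken in the sense of distributions, and $W^{2,s}_{\mathcal H}(\Omega)$ is the space of all $u\in L^s(\Omega)$ such that $Z_iu\in L^s(\Omega)$ and $Z_iZ_ju\in L^s(\Omega)$ for all $i,j\le 2n$. Put $\nabla^{\mathcal H}u=(Z_1u,\dots,Z_{2n}u)$ and $(\nabla^{2,\mathcal H}u)_{ij}=Z_iZ_ju$, and let $|\nabla^{2,\mathcal H}u|$ be the Euclidean operator norm of this matrix (the bound below then holds for the Frobenius norm too). **Theorem.** Let $s\in[1,\infty)$, let $\Omega\subseteq\mathbb H^n$ be open, let $f\in W^{2,s}_{\mathcal H}(\Omega)$, and let $A\subseteq\Omega$ be open with $\mathrm{dist}(A,\partial\Omega)>0$. Then $Tf\in L^s(\Omega)$, and for every $w\in\mathbb H^n$, $$\frac{f(p\cdot\delta_\varepsilon(w))-f(p)-\varepsilon\langle\nabla^{\mathcal H}f(p),w_{\mathcal H}\rangle}{\varepsilon^2}\;\longrightarrow\;\frac12\langle\nabla^{2,\mathcal H}f(p)\,w_{\mathcal H},w_{\mathcal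 H}\rangle+w_N\,Tf(p)$$ in $L^s(A)$, as functions of $p$, as $\varepsilon\searrow0$. Moreover, if $w\in\mathbb H^n$ and $\varepsilon>0$ satisfy $\varepsilon\bigl(|w_{\mathcal H}|+2\sqrt{|w_N|}\bigr)<\mathrm{dist}(A,\partial\Omega)$, then the difference quotient is in $L^s(A)$ and $$\left\|\frac{f(p\cdot\delta_\varepsilon(w))-f(p)-\varepsilon\langle\nabla^{\mathcal H}f(p),w_{\mathcal H}\rangle}{\varepsilon^2}\right\|_{L^s(A)}\le|w_N|\,\|Tf\|_{L^s(\Omega)}+|w_{\mathcal H}|^2\,\bigl\|\,|\nabla^{2,\mathcal H}f|\,\bigr\|_{L^s(\Omega)}.$$ -/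

import Mathlib

open MeasureTheory Filter Topology
open scoped ENNReal ContDiff

noncomputable section

/-- The underlying space `ℝ^{2n+1}` of the `n`-th Heisenberg group. A point is `p = (p.1, p.2)`,
where `p.1 = (x, y)` is the horizontal part (`x j = p.1 (Sum.inl j)`, `y j = p.1 (Sum.inr j)`, with
the Euclidean norm) and `p.2 = t` is the vertical part. The measure `volume` is Lebesgue measure. -/
abbrev Heis (n : ℕ) : Type := EuclideanSpace ℝ (Fin n ⊕ Fin n) × ℝ

namespace Heis

variable {n : ℕ}

/-- The group law
`(x, y, t) · (x', y', t') = (x + x', y + y', t + t' + 2 ∑ⱼ (x'ⱼ yⱼ - xⱼ y'ⱼ))`. -/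
def mul (p q : Heis n) : Heis n :=
  (p.1 + q.1, p.2 + q.2 + 2 * ∑ j : Fin n,
    (q.1 (Sum.inl j) * p.1 (Sum.inr j) - p.1 (Sum.inl j) * q.1 (Sum.inr j)))

/-- The intrinsic dilations `δ_r (x, y, t) = (r x, r y, r² t)`. -/
def dil (r : ℝ) (p : Heis n) : Heis n := (r • p.1, r ^ 2 * p.2)

/-- The left-invariant horizontal vector fields: `Z (inl j) = Xⱼ = ∂_{xⱼ} + 2 yⱼ ∂_t` and
`Z (inr j) = Yⱼ = ∂_{yⱼ} - 2 xⱼ ∂_t`. -/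
def Z : Fin n ⊕ Fin n → Heis n → Heis n
  | Sum.inl j, p => (EuclideanSpace.single (Sum.inl j) 1, 2 * p.1 (Sum.inr j))
  | Sum.inr j, p => (EuclideanSpace.single (Sum.inr j) 1, -2 * p.1 (Sum.inl j))

/-- The vertical vector field `T = ∂_t`. -/
def T : Heis n → Heis n := fun _ => (0, 1)

/-- `γ : [0, 1] → ℍⁿ` is an absolutely continuous horizontal curve: for almost every time the
velocity lies in the span of the `Xⱼ`, `Yⱼ` at the current point. -/
def IsHorizontalCurve (γ : ℝ → Heis n) : Prop :=
  AbsolutelyContinuousOnInterval γ 0 1 ∧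
    ∀ᵐ τ ∂(volume.restrict (Set.Icc (0 : ℝ) 1)),
      deriv γ τ ∈ Submodule.span ℝ (Set.range fun i => Z i (γ τ))

/-- The length of a horizontal curve for the metric that makes `X₁, …, Xₙ, Y₁, …, Yₙ, T`
orthonormal. The coefficients of a horizontal vector `∑ᵢ uᵢ Zᵢ` are the coordinates of its
horizontal part `u`, so its length is the Euclidean norm of that part. -/
def length (γ : ℝ → Heis n) : ℝ≥0∞ :=
  ∫⁻ τ in Set.Icc (0 : ℝ) 1, ‖(deriv γ τ).1‖ₑ

/-- The Carnot–Carathéodory distance. -/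
def ccDist (p q : Heis n) : ℝ≥0∞ :=
  ⨅ (γ : ℝ → Heis n) (_ : IsHorizontalCurve γ ∧ γ 0 = p ∧ γ 1 = q), length γ

/-- The distance between two sets for the Carnot–Carathéodory distance (`∞` if one is empty). -/
def ccSetDist (A B : Set (Heis n)) : ℝ≥0∞ := ⨅ (p ∈ A) (q ∈ B), ccDist p q

/-- `g` is the distributional derivative of `f` on `Ω` along the vector field `V`:
`∫_Ω f Vφ = - ∫_Ω g φ` for all `φ ∈ C_c^∞(Ω)`. It is used only for the fields `Z i` and `T`, which
have divergence zero. -/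
def HasWeakDeriv (Ω : Set (Heis n)) (V : Heis n → Heis n) (f g : Heis n → ℝ) : Prop :=
  LocallyIntegrableOn f Ω ∧ LocallyIntegrableOn g Ω ∧
    ∀ φ : Heis n → ℝ, ContDiff ℝ ∞ φ → HasCompactSupport φ → tsupport φ ⊆ Ω →
      ∫ p in Ω, f p * fderiv ℝ φ p (V p) = -∫ p in Ω, g p * φ p

open Classical in
/-- The distributional derivative of `f` on `Ω` along `V` (a representative, unique almost
everywhere on `Ω`) if it is a locally integrable function, and `0` otherwise. -/
def weakDeriv (Ω : Set (Heis n)) (V : Heis n → Heis n) (f : Heis n → ℝ) : Heis n → ℝ :=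
  if h : ∃ g, HasWeakDeriv Ω V f g then h.choose else 0

/-- The horizontal Sobolev space `W^{k,s}_H(Ω)`: all iterated distributional derivatives of `f`
along `X₁, …, Xₙ, Y₁, …, Yₙ` up to order `k` are in `L^s(Ω)`. -/
def MemSobolev (Ω : Set (Heis n)) (s : ℝ≥0∞) : ℕ → (Heis n → ℝ) → Prop
  | 0, f => MemLp f s (volume.restrict Ω)
  | k + 1, f => MemLp f s (volume.restrict Ω) ∧
      ∀ i, ∃ g, HasWeakDeriv Ω (Z i) f g ∧ MemSobolev Ω s k g

/-- The horizontal gradient `∇^H f = (X₁ f, …, Xₙ f, Y₁ f, …, Yₙ f)`. -/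
def hGrad (Ω : Set (Heis n)) (f : Heis n → ℝ) (p : Heis n) : EuclideanSpace ℝ (Fin n ⊕ Fin n) :=
  WithLp.toLp 2 fun i => weakDeriv Ω (Z i) f p

/-- The horizontal Hessian `(∇^{2,H} f)ᵢⱼ = Zᵢ Zⱼ f`, as a linear operator on `ℝ^{2n}`; its norm is
the operator norm for the Euclidean norm. -/
def hHess (Ω : Set (Heis n)) (f : Heis n → ℝ) (p : Heis n) :
    EuclideanSpace ℝ (Fin n ⊕ Fin n) →L[ℝ] EuclideanSpace ℝ (Fin n ⊕ Fin n) :=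
  Matrix.toEuclideanCLM (𝕜 := ℝ) (Matrix.of fun i j => weakDeriv Ω (Z i) (weakDeriv Ω (Z j) f) p)

/-- The second-order difference quotient
`(f(p · δ_ε w) - f(p) - ε ⟨∇^H f(p), w_H⟩) / ε²`. -/
def diffQuot₂ (Ω : Set (Heis n)) (f : Heis n → ℝ) (w : Heis n) (ε : ℝ) (p : Heis n) : ℝ :=
  (f (mul p (dil ε w)) - f p - ε * inner ℝ (hGrad Ω f p) w.1) / ε ^ 2

end Heis

end

/-! For fixed `w` the curve `τ ↦ p · (τ w)` is an integral curve of the left-invariant field `lvf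
w`, and the flow maps are right translations, which preserve Lebesgue measure. Hence the fundamental
theorem of calculus passes to distributional derivatives by duality: if `G` is the derivative of `F`
along `lvf w`, then `F (p · w) - F p` is the average of `G (p · (τ w))` over `τ ∈ [0, 1]`, for
almost every `p` whose path stays in `Ω` (`HasWeakDeriv.ae_mul_sub_eq_integral`). Minkowski's
inequality turns this into `L^s` estimates of Taylor remainders.

The displacement `(u, t)` is split as `(u, 0) · (0, t)`. Along `(u, 0)` the formula is used twice,
giving the gradient and Hessian terms. Along `(0, t)` it is used once, with `T f`, which lies in
`L^s` because `T` is a quarter of the commutator `Yⱼ Xⱼ - Xⱼ Yⱼ`. With `u = ε w_H` and `t = ε² w_N`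
both contributions have order `ε²`. The uniform bound follows from the invariance of `L^s` norms
under right translation, the limit from the continuity of right translation in `L^s`.

Paths from `A` stay in `Ω` because their points are within CC distance `‖u‖ + 2√|t|` of the start: a
vertical step is the net effect of the four sides of a horizontal square. This also allows every
function to be replaced by its extension by zero outside `Ω`. -/

noncomputable section

/-! ### Group law, left-invariant fields and right translations. -/

namespace Heis

variable {n : ℕ}

/-- The symplectic form that appears in the group law. -/
def symp (u v : EuclideanSpace ℝ (Fin n ⊕ Fin n)) : ℝ :=
  ∑ j : Fin n, (v (Sum.inl j) * u (Sum.inr j) - u (Sum.inl j) * v (Sum.inr j))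

/-- The left-invariant vector field whose flow is `τ ↦ p · (τ w)`. -/
def lvf (w p : Heis n) : Heis n := (w.1, w.2 + 2 * symp p.1 w.1)

lemma symp_add_left (u u' v : EuclideanSpace ℝ (Fin n ⊕ Fin n)) :
    symp (u + u') v = symp u v + symp u' v := by
  simp only [symp, ← Finset.sum_add_distrib, PiLp.add_apply]
  exact Finset.sum_congr rfl fun _ _ => by ring

lemma symp_add_right (u v v' : EuclideanSpace ℝ (Fin n ⊕ Fin n)) :
    symp u (v + v') = symp u v + symp u v' := by
  simp only [symp, ← Finset.sum_add_distrib, PiLp.add_apply]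
  exact Finset.sum_congr rfl fun _ _ => by ring

lemma symp_smul_left (c : ℝ) (u v : EuclideanSpace ℝ (Fin n ⊕ Fin n)) :
    symp (c • u) v = c * symp u v := by
  simp only [symp, Finset.mul_sum, PiLp.smul_apply, smul_eq_mul]
  exact Finset.sum_congr rfl fun _ _ => by ring

lemma symp_smul_right (c : ℝ) (u v : EuclideanSpace ℝ (Fin n ⊕ Fin n)) :
    symp u (c • v) = c * symp u v := by
  simp only [symp, Finset.mul_sum, PiLp.smul_apply, smul_eq_mul]
  exact Finset.sum_congr rfl fun _ _ => by ring

@[simp] lemma symp_self (u : EuclideanSpace ℝ (Fin n ⊕ Fin n)) : symp u u = 0 :=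
  Finset.sum_eq_zero fun _ _ => by ring

@[simp] lemma symp_zero_right (u : EuclideanSpace ℝ (Fin n ⊕ Fin n)) : symp u 0 = 0 := by
  simp [symp]

@[simp] lemma symp_zero_left (u : EuclideanSpace ℝ (Fin n ⊕ Fin n)) : symp 0 u = 0 := by
  simp [symp]

@[fun_prop]
lemma contDiff_symp {E : Type*} [NormedAddCommGroup E] [NormedSpace ℝ E] {k : WithTop ℕ∞}
    {f g : E → EuclideanSpace ℝ (Fin n ⊕ Fin n)} (hf : ContDiff ℝ k f) (hg : ContDiff ℝ k g) :
    ContDiff ℝ k fun x => symp (f x) (g x) := by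
  have hf' := contDiff_euclidean.1 hf
  have hg' := contDiff_euclidean.1 hg
  unfold symp
  exact ContDiff.sum fun j _ => ((hg' _).mul (hf' _)).sub ((hf' _).mul (hg' _))

@[fun_prop]
lemma continuous_symp {X : Type*} [TopologicalSpace X]
    {f g : X → EuclideanSpace ℝ (Fin n ⊕ Fin n)} (hf : Continuous f) (hg : Continuous g) :
    Continuous fun x => symp (f x) (g x) := by
  unfold symp
  fun_prop

lemma mul_eq (p q : Heis n) : mul p q = (p.1 + q.1, p.2 + q.2 + 2 * symp p.1 q.1) := rfl

lemma mul_eq_add_lvf (p w : Heis n) : mul p w = p + lvf w p := by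
  ext
  · rfl
  · simp only [mul_eq, lvf, Prod.snd_add]; ring

lemma lvf_smul (c : ℝ) (w p : Heis n) : lvf (c • w) p = c • lvf w p := by
  ext
  · rfl
  · simp only [lvf, Prod.smul_fst, Prod.smul_snd, smul_eq_mul, symp_smul_right]; ring

lemma mul_smul_eq_add (p w : Heis n) (τ : ℝ) : mul p (τ • w) = p + τ • lvf w p := by
  rw [mul_eq_add_lvf, lvf_smul]

@[simp] lemma mul_zero_right (p : Heis n) : mul p 0 = p := by
  simp [mul_eq]

lemma mul_assoc' (p q r : Heis n) : mul (mul p q) r = mul p (mul q r) := by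
  ext
  · simp [mul_eq, add_assoc]
  · simp only [mul_eq, symp_add_left, symp_add_right]; ring

/-- Multiples of `w` form a one-parameter subgroup because the symplectic form vanishes on parallel
vectors. -/
lemma mul_smul_smul (w : Heis n) (a b : ℝ) : mul (a • w) (b • w) = (a + b) • w := by
  ext
  · simp [mul_eq, add_smul]
  · simp [mul_eq, symp_smul_left, symp_smul_right, add_mul]

@[simp] lemma mul_neg_self (w : Heis n) : mul w (-w) = 0 := by
  simpa using mul_smul_smul w 1 (-1)

@[simp] lemma neg_mul_self (w : Heis n) : mul (-w) w = 0 := by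
  simpa using mul_smul_smul w (-1) 1

/-- The field is constant along its own orbits, again by `symp_self`; orbits are therefore Euclidean
straight lines. -/
lemma lvf_mul_smul (w p : Heis n) (τ : ℝ) : lvf w (mul p (τ • w)) = lvf w p := by
  ext
  · rfl
  · simp [lvf, mul_eq, symp_add_left, symp_smul_left]

@[fun_prop]
lemma contDiff_mul {E : Type*} [NormedAddCommGroup E] [NormedSpace ℝ E] {k : WithTop ℕ∞}
    {f g : E → Heis n} (hf : ContDiff ℝ k f) (hg : ContDiff ℝ k g) :
    ContDiff ℝ k fun x => mul (f x) (g x) := by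
  simp only [mul_eq]
  fun_prop

@[fun_prop]
lemma continuous_mul {X : Type*} [TopologicalSpace X] {f g : X → Heis n}
    (hf : Continuous f) (hg : Continuous g) : Continuous fun x => mul (f x) (g x) := by
  simp only [mul_eq]
  fun_prop

@[fun_prop]
lemma continuous_lvf {X : Type*} [TopologicalSpace X] {f g : X → Heis n}
    (hf : Continuous f) (hg : Continuous g) : Continuous fun x => lvf (f x) (g x) := by
  simp only [lvf]
  fun_prop

/-- Right translation by `w`. -/
def mulRight (w : Heis n) : Heis n ≃ₜ Heis n where
  toFun p := mul p w
  invFun p := mul p (-w)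
  left_inv p := by simp [mul_assoc']
  right_inv p := by simp [mul_assoc']
  continuous_toFun := by fun_prop
  continuous_invFun := by fun_prop

@[simp] lemma mulRight_apply (w p : Heis n) : mulRight w p = mul p w := rfl

/-- Lebesgue measure is invariant under right translations. -/
lemma measurePreserving_mulRight (w : Heis n) :
    MeasurePreserving (mulRight w) (volume : Measure (Heis n)) volume := by
  -- Right translation is a shear: a translation of the horizontal part, and on each vertical fibre
  -- a translation by an amount that depends only on the horizontal part.
  have h := (measurePreserving_add_right (volume : Measure (EuclideanSpace ℝ (Fin n ⊕ Fin n)))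
    w.1).skew_product (μc := (volume : Measure ℝ)) (μd := volume)
    (g := fun u t => t + (w.2 + 2 * symp u w.1)) (by
      simp only [Function.uncurry_def]
      exact Continuous.measurable (by fun_prop))
    (ae_of_all _ fun u => (measurePreserving_add_right (volume : Measure ℝ) _).map_eq)
  have heq : ⇑(mulRight w) = fun p : Heis n => (p.1 + w.1, p.2 + (w.2 + 2 * symp p.1 w.1)) := by
    funext p
    simp only [mulRight_apply, mul_eq, add_assoc]
  rw [heq]
  exact h

lemma integral_comp_mulRight (w : Heis n) (g : Heis n → ℝ) :
    ∫ p, g (mul p w) = ∫ p, g p :=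
  (measurePreserving_mulRight w).integral_comp (mulRight w).measurableEmbedding g

lemma Z_eq_lvf (i : Fin n ⊕ Fin n) (p : Heis n) :
    Z i p = lvf (EuclideanSpace.single i 1, 0) p := by
  rcases i with j | j
  · ext
    · rfl
    · simp [Z, lvf, symp]
  · ext
    · rfl
    · simp [Z, lvf, symp]

lemma T_eq_lvf (p : Heis n) : T p = lvf (0, 1) p := by
  simp [T, lvf]

lemma lvf_add (v w p : Heis n) : lvf (v + w) p = lvf v p + lvf w p := by
  ext
  · rfl
  · simp only [lvf, Prod.fst_add, Prod.snd_add, symp_add_right]; ring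

lemma lvf_zero (p : Heis n) : lvf 0 p = 0 := by
  simp [lvf]

lemma lvf_sum {ι : Type*} (I : Finset ι) (v : ι → Heis n) (p : Heis n) :
    lvf (∑ i ∈ I, v i) p = ∑ i ∈ I, lvf (v i) p := by
  classical
  induction I using Finset.induction_on with
  | empty => simp [lvf_zero]
  | insert a I ha ih => simp [Finset.sum_insert ha, lvf_add, ih]

lemma lvf_horizontal (u : EuclideanSpace ℝ (Fin n ⊕ Fin n)) (p : Heis n) :
    lvf (u, 0) p = ∑ i, u i • Z i p := by
  have hu : ((u, 0) : Heis n) = ∑ i, u i • ((EuclideanSpace.single i 1, 0) : Heis n) := by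
    refine Prod.ext ?_ ?_
    · rw [Prod.fst_sum]
      ext k
      simp [Finset.sum_apply, Pi.single_apply, -Fintype.sum_sum_type]
    · simp [Prod.snd_sum]
  rw [hu, lvf_sum]
  simp_rw [lvf_smul, ← Z_eq_lvf]

lemma lvf_horizontal_mem_span (u : EuclideanSpace ℝ (Fin n ⊕ Fin n)) (p : Heis n) :
    lvf (u, 0) p ∈ Submodule.span ℝ (Set.range fun i => Z i p) := by
  rw [lvf_horizontal]
  exact Submodule.sum_mem _ fun i _ =>
    Submodule.smul_mem _ _ (Submodule.subset_span ⟨i, rfl⟩)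

end Heis

/-! ### Upper bounds for the Carnot–Carathéodory distance. -/

namespace Heis

variable {n : ℕ}

/-- There is a Lipschitz horizontal curve, parametrized by `[0, b]`, of length at most `L` from `p`
to `q`. -/
def Reaches (b : ℝ) (p q : Heis n) (L : ℝ≥0∞) : Prop :=
  ∃ (γ : ℝ → Heis n) (K : NNReal), LipschitzWith K γ ∧ γ 0 = p ∧ γ b = q ∧
    (∀ᵐ τ ∂(volume.restrict (Set.Icc (0 : ℝ) b)),
      deriv γ τ ∈ Submodule.span ℝ (Set.range fun i => Z i (γ τ))) ∧
    ∫⁻ τ in Set.Icc (0 : ℝ) b, ‖(deriv γ τ).1‖ₑ ≤ L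

/-- Start of every concatenation. Since the final time `b` is free, segments can be appended without
reparametrizing; only the last one has to end at time 1. -/
lemma reaches_refl (p : Heis n) : Reaches 0 p p 0 :=
  ⟨fun _ => p, 0, LipschitzWith.const p, rfl, rfl, by simp, by simp⟩

/-- Across the junction the triangle inequality through `f b = g b` loses nothing, as `b` lies
between the two times. -/
lemma lipschitzWith_ite_le {X : Type*} [PseudoMetricSpace X] {f g : ℝ → X} {K : NNReal} {b : ℝ}
    (hf : LipschitzWith K f) (hg : LipschitzWith K g) (hfg : f b = g b) :
    LipschitzWith K fun τ => if τ ≤ b then f τ else g τ := by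
  have key : ∀ x y : ℝ, x ≤ b → b ≤ y → dist (f x) (g y) ≤ K * dist x y := by
    intro x y hx hy
    calc dist (f x) (g y) ≤ dist (f x) (f b) + dist (g b) (g y) := by
          rw [← hfg]; exact dist_triangle _ _ _
      _ ≤ K * dist x b + K * dist b y := add_le_add (hf.dist_le_mul _ _) (hg.dist_le_mul _ _)
      _ = K * dist x y := by
          rw [Real.dist_eq, Real.dist_eq, Real.dist_eq, abs_of_nonpos (by linarith),
            abs_of_nonpos (by linarith), abs_of_nonpos (by linarith)]
          ring
  refine LipschitzWith.of_dist_le_mul fun x y => ?_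
  split_ifs with hx hy hy
  · exact hf.dist_le_mul _ _
  · exact key x y hx (not_le.1 hy).le
  · rw [dist_comm, dist_comm x]; exact key y x hy (not_le.1 hx).le
  · exact hg.dist_le_mul _ _

/-- A horizontal curve can be prolonged by a horizontal segment. -/
lemma Reaches.extend {b b' : ℝ} {p q : Heis n} {L : ℝ≥0∞} (h : Reaches b p q L) (hb : 0 ≤ b)
    (hbb' : b < b') (v : EuclideanSpace ℝ (Fin n ⊕ Fin n)) :
    Reaches b' p (mul q (v, 0)) (L + ‖v‖ₑ) := by
  obtain ⟨γ, K, hγ, h0, h1, hhor, hlen⟩ := h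
  set c : ℝ := b' - b with hc
  have hc0 : 0 < c := sub_pos.2 hbb'
  set σ : ℝ → Heis n := fun τ => mul q (((τ - b) / c) • ((v, 0) : Heis n)) with hσ
  have hσd : ∀ τ, HasDerivAt σ (c⁻¹ • lvf (v, 0) q) τ := by
    intro τ
    have : HasDerivAt (fun τ : ℝ => (τ - b) / c) c⁻¹ τ := by
      simpa using ((hasDerivAt_id τ).sub_const b).div_const c
    have h2 := (this.smul_const (lvf (v, 0) q)).const_add q
    simpa only [hσ, mul_smul_eq_add] using h2
  have hσL : LipschitzWith ‖c⁻¹ • lvf (v, 0) q‖₊ σ :=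
    lipschitzWith_of_nnnorm_deriv_le (fun τ => (hσd τ).differentiableAt)
      fun τ => by rw [(hσd τ).deriv]
  have hσb : σ b = q := by simp only [hσ, sub_self, zero_div, zero_smul, mul_zero_right]
  set γ' : ℝ → Heis n := fun τ => if τ ≤ b then γ τ else σ τ with hγ'
  have hlt : ∀ τ < b, γ' =ᶠ[𝓝 τ] γ := fun τ hτ => by
    filter_upwards [Iio_mem_nhds hτ] with x hx
    exact if_pos (le_of_lt hx)
  have hgt : ∀ τ, b < τ → γ' =ᶠ[𝓝 τ] σ := fun τ hτ => by
    filter_upwards [Ioi_mem_nhds hτ] with x hx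
    exact if_neg (not_le.2 hx)
  have hunion : Set.Icc 0 b' = Set.Icc 0 b ∪ Set.Icc b b' :=
    (Set.Icc_union_Icc_eq_Icc hb hbb'.le).symm
  have hne : ∀ᵐ τ : ℝ, τ ≠ b := by simp [ae_iff]
  -- The constant velocity of `σ` is a multiple of the field at `q`, which equals the field at `σ τ`
  -- because it does not vary along the orbit.
  have hσspan : ∀ τ, deriv σ τ ∈ Submodule.span ℝ (Set.range fun i => Z i (σ τ)) := by
    intro τ
    rw [(hσd τ).deriv]
    refine Submodule.smul_mem _ _ ?_
    have := lvf_horizontal_mem_span v (σ τ)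
    rwa [hσ, lvf_mul_smul] at this
  refine ⟨γ', max K ‖c⁻¹ • lvf (v, 0) q‖₊, lipschitzWith_ite_le (hγ.weaken (le_max_left _ _))
    (hσL.weaken (le_max_right _ _)) (h1.trans hσb.symm), ?_, ?_, ?_, ?_⟩
  · simp [hγ', hb, h0]
  · simp [hγ', not_le.2 hbb', hσ, ← hc, div_self hc0.ne']
  · rw [hunion, ae_restrict_union_iff]
    constructor
    · filter_upwards [hhor, ae_restrict_of_ae hne, ae_restrict_mem measurableSet_Icc]
        with τ h1 h2 h3
      have := hlt τ (lt_of_le_of_ne h3.2 h2)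
      rwa [this.deriv_eq, this.eq_of_nhds]
    · filter_upwards [ae_restrict_of_ae hne, ae_restrict_mem measurableSet_Icc] with τ h2 h3
      have := hgt τ (lt_of_le_of_ne h3.1 h2.symm)
      rw [this.deriv_eq, this.eq_of_nhds]
      exact hσspan τ
  · rw [hunion]
    refine (lintegral_union_le _ _ _).trans (add_le_add ?_ ?_)
    · refine le_trans (lintegral_mono_ae ?_) hlen
      filter_upwards [ae_restrict_of_ae hne, ae_restrict_mem measurableSet_Icc] with τ h2 h3
      rw [(hlt τ (lt_of_le_of_ne h3.2 h2)).deriv_eq]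
    · have : ∫⁻ τ in Set.Icc b b', ‖(deriv γ' τ).1‖ₑ = ∫⁻ τ in Set.Icc b b', ‖c⁻¹ • v‖ₑ := by
        refine lintegral_congr_ae ?_
        filter_upwards [ae_restrict_of_ae hne, ae_restrict_mem measurableSet_Icc] with τ h2 h3
        rw [(hgt τ (lt_of_le_of_ne h3.1 h2.symm)).deriv_eq, (hσd τ).deriv]
        rfl
      -- Duration `c` times speed `‖v‖ / c`: the added length does not depend on the time interval.
      rw [this, setLIntegral_const, Real.volume_Icc, ← hc, enorm_smul, mul_right_comm,
        Real.enorm_eq_ofReal (inv_nonneg.2 hc0.le), ← ENNReal.ofReal_mul (inv_nonneg.2 hc0.le),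
        inv_mul_cancel₀ hc0.ne', ENNReal.ofReal_one, one_mul]

lemma Reaches.ccDist_le {p q : Heis n} {L : ℝ≥0∞} (h : Reaches 1 p q L) : ccDist p q ≤ L := by
  obtain ⟨γ, K, hγ, h0, h1, hhor, hlen⟩ := h
  exact iInf₂_le_of_le γ ⟨⟨(hγ.lipschitzOnWith).absolutelyContinuousOnInterval, hhor⟩, h0, h1⟩ hlen

/-- Four sides of a square give a vertical displacement. -/
lemma mul_square (p : Heis n) (j : Fin n) (a : ℝ) :
    mul (mul (mul (mul p (EuclideanSpace.single (Sum.inl j) a, 0))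
      (EuclideanSpace.single (Sum.inr j) a, 0)) (EuclideanSpace.single (Sum.inl j) (-a), 0))
      (EuclideanSpace.single (Sum.inr j) (-a), 0) = mul p (0, -4 * a ^ 2) := by
  simp only [mul_assoc']
  congr 1
  simp only [mul_eq]
  refine Prod.ext ?_ ?_
  · ext k
    simp only [PiLp.add_apply, PiLp.single_apply, PiLp.zero_apply]
    split_ifs <;> ring
  · simp only [symp, PiLp.single_apply, PiLp.add_apply, Sum.inl.injEq, Sum.inr.injEq,
      reduceCtorEq, if_false]
    simp
    ring

/-- Exchanging the two directions reverses the orientation of the square, hence the sign of the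
displacement. -/
lemma mul_square' (p : Heis n) (j : Fin n) (a : ℝ) :
    mul (mul (mul (mul p (EuclideanSpace.single (Sum.inr j) a, 0))
      (EuclideanSpace.single (Sum.inl j) a, 0)) (EuclideanSpace.single (Sum.inr j) (-a), 0))
      (EuclideanSpace.single (Sum.inl j) (-a), 0) = mul p (0, 4 * a ^ 2) := by
  simp only [mul_assoc']
  congr 1
  simp only [mul_eq]
  refine Prod.ext ?_ ?_
  · ext k
    simp only [PiLp.add_apply, PiLp.single_apply, PiLp.zero_apply]
    split_ifs <;> ring
  · simp only [symp, PiLp.single_apply, PiLp.add_apply, Sum.inl.injEq, Sum.inr.injEq,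
      reduceCtorEq, if_false]
    simp
    ring

/-- Following a horizontal segment and the sides of a square bounds the distance. -/
lemma ccDist_mul_mul_le (hn : 1 ≤ n) (p : Heis n) (u : EuclideanSpace ℝ (Fin n ⊕ Fin n)) (t : ℝ) :
    ccDist p (mul (mul p (u, 0)) (0, t)) ≤ ENNReal.ofReal (‖u‖ + 2 * √|t|) := by
  -- The side for which the square moves the point by height `4 a ^ 2 = |t|`; its perimeter `4 a` is
  -- the term `2 * √|t|`.
  set a : ℝ := √|t| / 2 with ha
  have ha0 : 0 ≤ a := by positivity
  have ha2 : 4 * a ^ 2 = |t| := by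
    rw [ha, div_pow, Real.sq_sqrt (abs_nonneg t)]; ring
  have main : ∀ (i k : Fin n ⊕ Fin n), ccDist p (mul (mul (mul (mul (mul p (u, 0))
      (EuclideanSpace.single i a, 0)) (EuclideanSpace.single k a, 0))
      (EuclideanSpace.single i (-a), 0)) (EuclideanSpace.single k (-a), 0)) ≤
      ENNReal.ofReal (‖u‖ + 2 * √|t|) := by
    intro i k
    have h := ((((((reaches_refl p).extend le_rfl (b' := 1 / 5) (by norm_num) u).extend
      (by norm_num) (b' := 2 / 5) (by norm_num) (EuclideanSpace.single i a)).extend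
      (by norm_num) (b' := 3 / 5) (by norm_num) (EuclideanSpace.single k a)).extend
      (by norm_num) (b' := 4 / 5) (by norm_num) (EuclideanSpace.single i (-a))).extend
      (by norm_num) (b' := 1) (by norm_num) (EuclideanSpace.single k (-a))).ccDist_le
    refine h.trans_eq ?_
    simp only [← ofReal_norm, PiLp.norm_single, norm_neg, zero_add]
    rw [Real.norm_of_nonneg ha0, ← ENNReal.ofReal_add (by positivity) ha0,
      ← ENNReal.ofReal_add (by positivity) ha0, ← ENNReal.ofReal_add (by positivity) ha0,
      ← ENNReal.ofReal_add (by positivity) ha0]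
    congr 1
    rw [ha]; ring
  rcases le_total 0 t with ht | ht
  · have := main (Sum.inr ⟨0, hn⟩) (Sum.inl ⟨0, hn⟩)
    rwa [mul_square', ha2, show (0, |t|) = ((0, t) : Heis n) by rw [abs_of_nonneg ht]] at this
  · have := main (Sum.inl ⟨0, hn⟩) (Sum.inr ⟨0, hn⟩)
    rwa [mul_square, neg_mul, ha2, abs_of_nonpos ht, neg_neg, ← abs_of_nonpos ht] at this

/-- A path that starts in `Ω` and stays close to a point of `A` does not leave `Ω`. -/
lemma mem_of_ccDist_lt {A Ω : Set (Heis n)} (hΩ : IsOpen Ω) {p : Heis n} (hp : p ∈ A)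
    {c : ℝ → Heis n} (hc : Continuous c) (h0 : c 0 ∈ Ω)
    (hlt : ∀ r ∈ Set.Icc (0 : ℝ) 1, ccDist p (c r) < ccSetDist A (frontier Ω)) {r : ℝ}
    (hr : r ∈ Set.Icc (0 : ℝ) 1) : c r ∈ Ω := by
  by_contra hcr
  have hpre : IsPreconnected (c '' Set.Icc (0 : ℝ) 1) := isPreconnected_Icc.image c hc.continuousOn
  have hnot : ∀ x ∈ Set.Icc (0 : ℝ) 1, c x ∉ frontier Ω := fun x hx hxf =>
    absurd (hlt x hx) (not_lt.2 (iInf₂_le_of_le p hp (iInf₂_le _ hxf)))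
  have hout : ∀ x ∈ Set.Icc (0 : ℝ) 1, c x ∉ Ω → c x ∈ (closure Ω)ᶜ := fun x hx hx' hcl =>
    hnot x hx (hΩ.frontier_eq ▸ ⟨hcl, hx'⟩)
  -- The path avoids the frontier, so the disjoint open sets `Ω` and `(closure Ω)ᶜ` cover its
  -- connected image; it cannot meet both.
  obtain ⟨y, -, hy, hy'⟩ := hpre Ω (closure Ω)ᶜ hΩ isClosed_closure.isOpen_compl
    (by
      rintro _ ⟨x, hx, rfl⟩
      by_cases h : c x ∈ Ω
      · exact Or.inl h
      · exact Or.inr (hout x hx h))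
    ⟨_, ⟨0, by simp, rfl⟩, h0⟩ ⟨_, ⟨r, hr, rfl⟩, hout r hr hcr⟩
  exact hy' (subset_closure hy)

end Heis

/-! ### Averages and right translations in `L^s`. -/

lemma eLpNorm_rpow_toReal {X : Type*} [MeasurableSpace X] {s : ℝ≥0∞} (hs0 : s ≠ 0) (hs : s ≠ ⊤)
    (μ : Measure X) (g : X → ℝ) :
    eLpNorm g s μ ^ s.toReal = ∫⁻ x, ‖g x‖ₑ ^ s.toReal ∂μ := by
  rw [eLpNorm_eq_lintegral_rpow_enorm_toReal hs0 hs, ← ENNReal.rpow_mul,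
    one_div_mul_cancel (ENNReal.toReal_pos hs0 hs).ne', ENNReal.rpow_one]

/-- Minkowski's integral inequality for averages: the `L^s` norm of an average is at most a common
bound of the `L^s` norms. -/
theorem eLpNorm_integral_le_of_forall_le {X Y : Type*} [MeasurableSpace X] [MeasurableSpace Y]
    {ν : Measure Y} [IsProbabilityMeasure ν] {μ : Measure X} [SFinite μ] {s : ℝ≥0∞} (hs1 : 1 ≤ s)
    (hs : s ≠ ⊤) {K : Y → X → ℝ} (hK : AEStronglyMeasurable (Function.uncurry K) (ν.prod μ))
    {C : ℝ≥0∞} (hC : ∀ᵐ τ ∂ν, eLpNorm (K τ) s μ ≤ C) :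
    eLpNorm (fun x => ∫ τ, K τ x ∂ν) s μ ≤ C := by
  have hs0 : s ≠ 0 := (one_pos.trans_le hs1).ne'
  have hr : 0 < s.toReal := ENNReal.toReal_pos hs0 hs
  rw [← ENNReal.rpow_le_rpow_iff hr, eLpNorm_rpow_toReal hs0 hs]
  have hsec : ∀ᵐ x ∂μ, AEStronglyMeasurable (fun τ => K τ x) ν :=
    hK.prod_swap.prodMk_left
  calc ∫⁻ x, ‖∫ τ, K τ x ∂ν‖ₑ ^ s.toReal ∂μ
      ≤ ∫⁻ x, ∫⁻ τ, ‖K τ x‖ₑ ^ s.toReal ∂ν ∂μ := by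
        -- Jensen in `τ`, in the form that `L^1` norms are at most `L^s` norms on a probability
        -- space.
        refine lintegral_mono_ae ?_
        filter_upwards [hsec] with x hx
        rw [← eLpNorm_rpow_toReal hs0 hs ν fun τ => K τ x]
        refine ENNReal.rpow_le_rpow ?_ hr.le
        calc ‖∫ τ, K τ x ∂ν‖ₑ ≤ ∫⁻ τ, ‖K τ x‖ₑ ∂ν := enorm_integral_le_lintegral_enorm _
          _ = eLpNorm (fun τ => K τ x) 1 ν := eLpNorm_one_eq_lintegral_enorm.symm
          _ ≤ _ := eLpNorm_le_eLpNorm_of_exponent_le hs1 hx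
    _ = ∫⁻ τ, ∫⁻ x, ‖K τ x‖ₑ ^ s.toReal ∂μ ∂ν :=
        (lintegral_lintegral_swap (hK.enorm.pow_const _)).symm
    _ ≤ ∫⁻ _, C ^ s.toReal ∂ν := by
        refine lintegral_mono_ae ?_
        filter_upwards [hC] with τ hτ
        rw [← eLpNorm_rpow_toReal hs0 hs]
        exact ENNReal.rpow_le_rpow hτ hr.le
    _ = C ^ s.toReal := by simp

namespace Heis

variable {n : ℕ}

instance : IsProbabilityMeasure (volume.restrict (Set.Icc (0 : ℝ) 1)) := ⟨by simp⟩

/-- Right translations act continuously on `L^s`. -/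
theorem tendsto_eLpNorm_mul_sub {s : ℝ≥0∞} (hs1 : 1 ≤ s) (hs : s ≠ ⊤) {F : Heis n → ℝ}
    (hF : MemLp F s volume) :
    Tendsto (fun q : Heis n => eLpNorm (fun p => F (mul p q) - F p) s volume) (𝓝 0) (𝓝 0) := by
  have : Fact (1 ≤ s) := ⟨hs1⟩
  let g : Heis n → C(Heis n, Heis n) := fun q => ⟨fun p => mul p q, by fun_prop⟩
  have hg : Continuous g := ContinuousMap.continuous_of_continuous_uncurry _ (by
    simp only [Function.uncurry_def, g, ContinuousMap.coe_mk]
    fun_prop)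
  have hgm : ∀ q, MeasurePreserving (g q) (volume : Measure (Heis n)) volume :=
    fun q => measurePreserving_mulRight q
  have hcont : Continuous fun q => Lp.compMeasurePreserving (g q) (hgm q) (hF.toLp F) :=
    continuous_const.compMeasurePreservingLp hg hgm hs
  have h1 : Tendsto (fun q => ‖Lp.compMeasurePreserving (g q) (hgm q) (hF.toLp F) -
      Lp.compMeasurePreserving (g 0) (hgm 0) (hF.toLp F)‖ₑ) (𝓝 0) (𝓝 0) := by
    have := ((hcont.sub continuous_const).enorm).tendsto (0 : Heis n)
      (f := fun q => ‖Lp.compMeasurePreserving (g q) (hgm q) (hF.toLp F) -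
      Lp.compMeasurePreserving (g 0) (hgm 0) (hF.toLp F)‖ₑ)
    simpa using this
  refine h1.congr fun q => ?_
  rw [Lp.toLp_compMeasurePreserving, Lp.toLp_compMeasurePreserving, ← MemLp.toLp_sub,
    Lp.enorm_toLp]
  congr 1
  funext p
  simp [g]

/-- The map `(τ, p) ↦ (τ, p · (τ w))` preserves the product measure. -/
lemma measurePreserving_prod_mul_smul (ν : Measure ℝ) [SFinite ν] (w : Heis n) :
    MeasurePreserving (fun z : ℝ × Heis n => (z.1, mul z.2 (z.1 • w))) (ν.prod volume)
      (ν.prod volume) :=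
  (MeasurePreserving.id ν).skew_product (g := fun τ p => mul p (τ • w))
    (by
      simp only [Function.uncurry_def]
      exact Continuous.measurable (by fun_prop))
    (ae_of_all _ fun τ => (measurePreserving_mulRight (τ • w)).map_eq)

lemma aestronglyMeasurable_comp_mul_smul {ν : Measure ℝ} [SFinite ν] {G : Heis n → ℝ}
    (hG : AEStronglyMeasurable G volume) (w : Heis n) :
    AEStronglyMeasurable (fun z : ℝ × Heis n => G (mul z.2 (z.1 • w))) (ν.prod volume) :=
  hG.comp_quasiMeasurePreserving
    (Measure.quasiMeasurePreserving_snd.comp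
      (measurePreserving_prod_mul_smul ν w).quasiMeasurePreserving)

lemma memLp_comp_mul {s : ℝ≥0∞} {G : Heis n → ℝ} (hG : MemLp G s volume) (w : Heis n) :
    MemLp (fun p => G (mul p w)) s volume :=
  hG.comp_measurePreserving (measurePreserving_mulRight w)

lemma eLpNorm_comp_mul {s : ℝ≥0∞} {G : Heis n → ℝ} (hG : AEStronglyMeasurable G volume)
    (w : Heis n) : eLpNorm (fun p => G (mul p w)) s volume = eLpNorm G s volume :=
  eLpNorm_comp_measurePreserving hG (measurePreserving_mulRight w)

end Heis

/-! ### Calculus of distributional derivatives; the vertical derivative as a commutator. -/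

namespace Heis

variable {n : ℕ} {Ω : Set (Heis n)}

lemma integrable_mul_of_tsupport_subset {f ψ : Heis n → ℝ} (hf : LocallyIntegrableOn f Ω)
    (hψ : Continuous ψ) (hc : HasCompactSupport ψ) (hsub : tsupport ψ ⊆ Ω) :
    Integrable (fun p => f p * ψ p) := by
  have h1 : IntegrableOn (fun p => f p * ψ p) (tsupport ψ) :=
    (hf.integrableOn_compact_subset hsub hc).mul_continuousOn hψ.continuousOn hc
  refine (integrableOn_iff_integrable_of_support_subset fun p hp => ?_).1 h1
  exact subset_tsupport ψ (right_ne_zero_of_mul hp)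

lemma setIntegral_mul_eq {f ψ : Heis n → ℝ} (hsub : tsupport ψ ⊆ Ω) :
    ∫ p in Ω, f p * ψ p = ∫ p, f p * ψ p := by
  refine setIntegral_eq_integral_of_forall_compl_eq_zero fun p hp => ?_
  rw [image_eq_zero_of_notMem_tsupport fun h => hp (hsub h), mul_zero]

lemma contDiff_fderiv_lvf {φ : Heis n → ℝ} (hφ : ContDiff ℝ ∞ φ) (w : Heis n) :
    ContDiff ℝ ∞ fun p => fderiv ℝ φ p (lvf w p) := by
  have h1 : ContDiff ℝ ∞ (fderiv ℝ φ) := hφ.fderiv_right le_rfl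
  refine h1.clm_apply ?_
  unfold lvf
  fun_prop

lemma tsupport_fderiv_lvf_subset (φ : Heis n → ℝ) (w : Heis n) :
    tsupport (fun p => fderiv ℝ φ p (lvf w p)) ⊆ tsupport φ := by
  refine (closure_mono fun p hp => ?_).trans (tsupport_fderiv_subset ℝ (f := φ))
  intro h
  exact hp (by simp [h])

lemma hasCompactSupport_fderiv_lvf {φ : Heis n → ℝ} (hφ : HasCompactSupport φ) (w : Heis n) :
    HasCompactSupport fun p => fderiv ℝ φ p (lvf w p) :=
  hφ.of_isClosed_subset (isClosed_tsupport _) (tsupport_fderiv_lvf_subset φ w)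

lemma HasWeakDeriv.congr_ae {V : Heis n → Heis n} {f f' g g' : Heis n → ℝ}
    (h : HasWeakDeriv Ω V f g) (hf : f =ᵐ[volume.restrict Ω] f')
    (hg : g =ᵐ[volume.restrict Ω] g') : HasWeakDeriv Ω V f' g' := by
  refine ⟨h.1.congr hf, h.2.1.congr hg, fun φ h1 h2 h3 => ?_⟩
  have e1 := integral_congr_ae (hf.mul (ae_eq_refl fun p => fderiv ℝ φ p (V p)))
  have e2 := integral_congr_ae (hg.mul (ae_eq_refl φ))
  exact e1.symm.trans ((h.2.2 φ h1 h2 h3).trans (congrArg Neg.neg e2))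

/-- Distributional derivatives are unique almost everywhere. -/
lemma HasWeakDeriv.ae_eq (hΩ : IsOpen Ω) {V : Heis n → Heis n} {f g g' : Heis n → ℝ}
    (h : HasWeakDeriv Ω V f g) (h' : HasWeakDeriv Ω V f g') : g =ᵐ[volume.restrict Ω] g' := by
  have key := hΩ.ae_eq_zero_of_integral_contDiff_smul_eq_zero (μ := volume)
    (f := fun p => g p - g' p) (h.2.1.sub h'.2.1) (fun φ h1 h2 h3 => by
      have e : -∫ p in Ω, g p * φ p = -∫ p in Ω, g' p * φ p :=
        (h.2.2 φ h1 h2 h3).symm.trans (h'.2.2 φ h1 h2 h3)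
      rw [setIntegral_mul_eq h3, setIntegral_mul_eq h3, neg_inj] at e
      have i1 := integrable_mul_of_tsupport_subset h.2.1 h1.continuous h2 h3
      have i2 := integrable_mul_of_tsupport_subset h'.2.1 h1.continuous h2 h3
      have : (fun p => φ p • (g p - g' p)) = fun p => g p * φ p - g' p * φ p := by
        funext p; rw [smul_eq_mul]; ring
      rw [this, integral_sub i1 i2, e, sub_self])
  refine (ae_restrict_iff' hΩ.measurableSet).2 ?_
  filter_upwards [key] with p hp hpΩ
  exact sub_eq_zero.1 (hp hpΩ)

lemma HasWeakDeriv.weakDeriv {V : Heis n → Heis n} {f g : Heis n → ℝ}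
    (h : HasWeakDeriv Ω V f g) : HasWeakDeriv Ω V f (weakDeriv Ω V f) := by
  have hex : ∃ g, HasWeakDeriv Ω V f g := ⟨g, h⟩
  rw [Heis.weakDeriv, dif_pos hex]
  exact hex.choose_spec

lemma HasWeakDeriv.smul_field {w : Heis n} {f g : Heis n → ℝ} (h : HasWeakDeriv Ω (lvf w) f g)
    (c : ℝ) : HasWeakDeriv Ω (lvf (c • w)) f fun p => c * g p := by
  refine ⟨h.1, h.2.1.smul c, fun φ h1 h2 h3 => ?_⟩
  simp only [lvf_smul, map_smul, smul_eq_mul, mul_left_comm _ c, mul_assoc, integral_const_mul]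
  rw [h.2.2 φ h1 h2 h3]
  ring

lemma locallyIntegrableOn_sum_mul {ι : Type*} (I : Finset ι) (u : ι → ℝ) {g : ι → Heis n → ℝ}
    (hg : ∀ i, LocallyIntegrableOn (g i) Ω) :
    LocallyIntegrableOn (fun p => ∑ i ∈ I, u i * g i p) Ω := by
  classical
  induction I using Finset.induction_on with
  | empty => simpa using locallyIntegrableOn_zero
  | insert a I ha ih =>
    simp only [Finset.sum_insert ha]
    exact ((hg a).smul (u a)).add ih

lemma integral_sum_mul_test {ι : Type*} [Fintype ι] (u : ι → ℝ) {g : ι → Heis n → ℝ}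
    (hg : ∀ i, LocallyIntegrableOn (g i) Ω) {ψ : Heis n → ℝ} (hψ : Continuous ψ)
    (hc : HasCompactSupport ψ) (hsub : tsupport ψ ⊆ Ω) :
    ∫ p in Ω, (∑ i, u i * g i p) * ψ p = ∑ i, u i * ∫ p in Ω, g i p * ψ p := by
  simp only [Finset.sum_mul, mul_assoc]
  rw [integral_finsetSum _ fun i _ =>
    ((integrable_mul_of_tsupport_subset (hg i) hψ hc hsub).integrableOn).const_mul (u i)]
  simp only [integral_const_mul]

/-- Distributional derivatives along a horizontal left-invariant field. -/
lemma hasWeakDeriv_lvf_horizontal {f : Heis n → ℝ} {g : Fin n ⊕ Fin n → Heis n → ℝ}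
    (hf : LocallyIntegrableOn f Ω) (h : ∀ i, HasWeakDeriv Ω (Z i) f (g i))
    (u : EuclideanSpace ℝ (Fin n ⊕ Fin n)) :
    HasWeakDeriv Ω (lvf (u, 0)) f fun p => ∑ i, u i * g i p := by
  refine ⟨hf, locallyIntegrableOn_sum_mul _ _ fun i => (h i).2.1, fun φ h1 h2 h3 => ?_⟩
  rw [integral_sum_mul_test _ (fun i => (h i).2.1) h1.continuous h2 h3]
  simp only [lvf_horizontal, map_sum, map_smul, smul_eq_mul, Finset.mul_sum, mul_left_comm (f _)]
  rw [integral_finsetSum _ fun i _ => ?_]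
  · simp only [integral_const_mul, (h _).2.2 φ h1 h2 h3, mul_neg, Finset.sum_neg_distrib]
  · simp only [Z_eq_lvf]
    exact ((integrable_mul_of_tsupport_subset hf (contDiff_fderiv_lvf h1 _).continuous
      (hasCompactSupport_fderiv_lvf h2 _)
      ((tsupport_fderiv_lvf_subset φ _).trans h3)).integrableOn).const_mul (u i)

lemma hasWeakDeriv_sum_mul {ι : Type*} [Fintype ι] {w : Heis n} {f g : ι → Heis n → ℝ}
    (h : ∀ i, HasWeakDeriv Ω (lvf w) (f i) (g i)) (u : ι → ℝ) :
    HasWeakDeriv Ω (lvf w) (fun p => ∑ i, u i * f i p) fun p => ∑ i, u i * g i p := by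
  refine ⟨locallyIntegrableOn_sum_mul _ _ fun i => (h i).1,
    locallyIntegrableOn_sum_mul _ _ fun i => (h i).2.1, fun φ h1 h2 h3 => ?_⟩
  rw [integral_sum_mul_test _ (fun i => (h i).2.1) h1.continuous h2 h3,
    integral_sum_mul_test _ (fun i => (h i).1) (contDiff_fderiv_lvf h1 _).continuous
      (hasCompactSupport_fderiv_lvf h2 _) ((tsupport_fderiv_lvf_subset φ _).trans h3)]
  simp only [(h _).2.2 φ h1 h2 h3, mul_neg, Finset.sum_neg_distrib]

/-- Product rule for an affine field: the second-derivative term is symmetric in `v` and `w`, so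
only the vertical term survives in the commutator. -/
lemma fderiv_fderiv_lvf {φ : Heis n → ℝ} (hφ : ContDiff ℝ ∞ φ) (v w p : Heis n) :
    fderiv ℝ (fun q => fderiv ℝ φ q (lvf w q)) p (lvf v p) =
      fderiv ℝ (fderiv ℝ φ) p (lvf v p) (lvf w p) + fderiv ℝ φ p (0, 2 * symp v.1 w.1) := by
  have h1 : ContDiff ℝ ∞ (fderiv ℝ φ) := hφ.fderiv_right le_rfl
  have h2 : HasFDerivAt (fderiv ℝ φ) (fderiv ℝ (fderiv ℝ φ) p) p :=
    (h1.differentiable (by simp)).differentiableAt.hasFDerivAt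
  have h3 : ContDiff ℝ ∞ (lvf w) := by
    unfold lvf
    fun_prop
  have h4 : HasFDerivAt (lvf w) (fderiv ℝ (lvf w) p) p :=
    (h3.differentiable (by simp)).differentiableAt.hasFDerivAt
  have h5 : fderiv ℝ (lvf w) p (lvf v p) = (0, 2 * symp v.1 w.1) := by
    have hd : HasDerivAt (fun τ : ℝ => lvf w (p + τ • lvf v p))
        (fderiv ℝ (lvf w) p (lvf v p)) 0 := by
      have hl : HasDerivAt (fun τ : ℝ => p + τ • lvf v p) (lvf v p) 0 := by
        simpa using ((hasDerivAt_id (0 : ℝ)).smul_const (lvf v p)).const_add p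
      exact HasFDerivAt.comp_hasDerivAt (f := fun τ : ℝ => p + τ • lvf v p) (0 : ℝ)
        (by simpa using h4) hl
    have hd' : HasDerivAt (fun τ : ℝ => lvf w (p + τ • lvf v p)) (0, 2 * symp v.1 w.1) 0 := by
      have e : (fun τ : ℝ => lvf w (p + τ • lvf v p)) =
          fun τ : ℝ => lvf w p + τ • ((0, 2 * symp v.1 w.1) : Heis n) := by
        funext τ
        ext
        · simp [lvf]
        · simp only [lvf, Prod.fst_add, Prod.smul_fst, symp_add_left, symp_smul_left,
            Prod.snd_add, Prod.smul_snd, smul_eq_mul]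
          ring
      rw [e]
      simpa using ((hasDerivAt_id (0 : ℝ)).smul_const ((0, 2 * symp v.1 w.1) : Heis n)).const_add
        (lvf w p)
    exact hd.unique hd'
  rw [(h2.clm_apply h4).fderiv]
  simp [h5, add_comm]

/-- The commutator of two left-invariant fields is vertical. -/
lemma fderiv_lvf_commutator {φ : Heis n → ℝ} (hφ : ContDiff ℝ ∞ φ) (v w p : Heis n) :
    fderiv ℝ (fun q => fderiv ℝ φ q (lvf w q)) p (lvf v p) -
      fderiv ℝ (fun q => fderiv ℝ φ q (lvf v q)) p (lvf w p) =
      4 * symp v.1 w.1 * fderiv ℝ φ p (T p) := by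
  have hsymm := ((contDiff_infty.1 hφ 2).contDiffAt (x := p)).isSymmSndFDerivAt (by simp)
  have hanti : symp w.1 v.1 = -symp v.1 w.1 := by
    simp only [symp, ← Finset.sum_neg_distrib]
    exact Finset.sum_congr rfl fun _ _ => by ring
  have hT : ∀ c : ℝ, fderiv ℝ φ p (0, c) = c * fderiv ℝ φ p (T p) := by
    intro c
    rw [← smul_eq_mul, ← map_smul]
    simp [T]
  rw [fderiv_fderiv_lvf hφ, fderiv_fderiv_lvf hφ, hsymm.eq (lvf v p) (lvf w p), hT, hT, hanti]
  ring

/-- The vertical derivative is a commutator of horizontal derivatives. -/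
lemma hasWeakDeriv_T (j : Fin n) {f g₁ g₂ h₁ h₂ : Heis n → ℝ}
    (hg₁ : HasWeakDeriv Ω (Z (Sum.inl j)) f g₁) (hg₂ : HasWeakDeriv Ω (Z (Sum.inr j)) f g₂)
    (hh₁ : HasWeakDeriv Ω (Z (Sum.inr j)) g₁ h₁) (hh₂ : HasWeakDeriv Ω (Z (Sum.inl j)) g₂ h₂) :
    HasWeakDeriv Ω T f fun p => (1 / 4 : ℝ) * (h₁ p - h₂ p) := by
  refine ⟨hg₁.1, (hh₁.2.1.sub hh₂.2.1).smul (1 / 4 : ℝ), fun φ h1 h2 h3 => ?_⟩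
  have hZ : ∀ i, Z i = lvf ((EuclideanSpace.single i 1, 0) : Heis n) := fun i =>
    funext (Z_eq_lvf i)
  rw [hZ] at hg₁ hg₂ hh₁ hh₂
  set a : Heis n := (EuclideanSpace.single (Sum.inl j) 1, 0)
  set b : Heis n := (EuclideanSpace.single (Sum.inr j) 1, 0)
  -- Hence `Xⱼ Yⱼ - Yⱼ Xⱼ = -4 T`, the origin of the factor `1 / 4` and of the order of `h₁` and
  -- `h₂`.
  have hab : symp a.1 b.1 = -1 := by simp [symp, a, b]
  have s1 := fun w => contDiff_fderiv_lvf h1 w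
  have s2 := fun w => hasCompactSupport_fderiv_lvf h2 w
  have s3 := fun w => (tsupport_fderiv_lvf_subset φ w).trans h3
  have int2 : ∀ v w : Heis n, IntegrableOn
      (fun p => f p * fderiv ℝ (fun q => fderiv ℝ φ q (lvf w q)) p (lvf v p)) Ω := fun v w =>
    (integrable_mul_of_tsupport_subset hg₁.1 (contDiff_fderiv_lvf (s1 w) v).continuous
      (hasCompactSupport_fderiv_lvf (s2 w) v)
      ((tsupport_fderiv_lvf_subset _ v).trans (s3 w))).integrableOn
  -- The derivatives of `φ` along `b` and `a` are admissible test functions, so second derivatives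
  -- of `φ` are moved onto `f` one at a time.
  have e1 := hg₁.2.2 _ (s1 b) (s2 b) (s3 b)
  have e2 := hg₂.2.2 _ (s1 a) (s2 a) (s3 a)
  have e3 := hh₁.2.2 φ h1 h2 h3
  have e4 := hh₂.2.2 φ h1 h2 h3
  have hT : ∀ p, f p * fderiv ℝ φ p (T p) = (-1 / 4 : ℝ) *
      (f p * fderiv ℝ (fun q => fderiv ℝ φ q (lvf b q)) p (lvf a p) -
        f p * fderiv ℝ (fun q => fderiv ℝ φ q (lvf a q)) p (lvf b p)) := by
    intro p
    rw [← mul_sub, fderiv_lvf_commutator h1, hab]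
    ring
  have hR : ∀ p, (1 / 4 : ℝ) * (h₁ p - h₂ p) * φ p = (1 / 4 : ℝ) * (h₁ p * φ p - h₂ p * φ p) :=
    fun p => by ring
  simp only [hT, hR, integral_const_mul]
  rw [integral_sub (int2 a b) (int2 b a), integral_sub
    (integrable_mul_of_tsupport_subset hh₁.2.1 h1.continuous h2 h3).integrableOn
    (integrable_mul_of_tsupport_subset hh₂.2.1 h1.continuous h2 h3).integrableOn]
  linarith

end Heis

/-! ### The fundamental theorem of calculus along flows, in weak form. -/

namespace Heis

variable {n : ℕ} {Ω A : Set (Heis n)}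

/-- Supplies the integrability for Fubini: the product is dominated by the maximum of `|D|` on `[0,
1] × K` times `|F|` on `K`. -/
lemma integrable_mul_prod_of_compact {F : Heis n → ℝ} (hF : LocallyIntegrable F volume)
    {D : ℝ × Heis n → ℝ} (hD : Continuous D) {K : Set (Heis n)} (hK : IsCompact K)
    (hDK : ∀ τ ∈ Set.Icc (0 : ℝ) 1, ∀ q ∉ K, D (τ, q) = 0) :
    Integrable (fun z : ℝ × Heis n => F z.2 * D z)
      ((volume.restrict (Set.Icc (0 : ℝ) 1)).prod volume) := by
  obtain ⟨C, hC⟩ := (isCompact_Icc (a := (0 : ℝ)) (b := 1)).prod hK |>.exists_bound_of_continuousOn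
    hD.continuousOn
  have hbd : Integrable (fun z : ℝ × Heis n => C * K.indicator (fun q => ‖F q‖) z.2)
      ((volume.restrict (Set.Icc (0 : ℝ) 1)).prod volume) := by
    have : Integrable (K.indicator fun q => ‖F q‖) volume :=
      (integrable_indicator_iff hK.measurableSet).2 (hF.integrableOn_isCompact hK).norm
    exact (this.const_mul C).comp_snd _
  refine hbd.mono' ?_ ?_
  · exact (hF.aestronglyMeasurable.comp_snd).mul hD.aestronglyMeasurable
  · have hmem : ∀ᵐ z : ℝ × Heis n ∂((volume.restrict (Set.Icc (0 : ℝ) 1)).prod volume),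
        z.1 ∈ Set.Icc (0 : ℝ) 1 :=
      Measure.quasiMeasurePreserving_fst.ae (ae_restrict_mem measurableSet_Icc)
    filter_upwards [hmem] with z hz
    by_cases hzK : z.2 ∈ K
    · rw [Set.indicator_of_mem hzK, norm_mul, mul_comm]
      exact mul_le_mul_of_nonneg_right (hC z ⟨hz, hzK⟩) (norm_nonneg _)
    · rw [show D z = 0 from hDK z.1 hz z.2 hzK, Set.indicator_of_notMem hzK]
      simp

lemma hasDerivAt_comp_mul_smul {φ : Heis n → ℝ} (hφ : ContDiff ℝ ∞ φ) (w p : Heis n) (τ : ℝ) :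
    HasDerivAt (fun σ : ℝ => φ (mul p (σ • w))) (fderiv ℝ φ (mul p (τ • w)) (lvf w p)) τ := by
  have hl : HasDerivAt (fun σ : ℝ => mul p (σ • w)) (lvf w p) τ := by
    simp only [mul_smul_eq_add]
    simpa using ((hasDerivAt_id τ).smul_const (lvf w p)).const_add p
  exact ((hφ.differentiable (by simp)).differentiableAt.hasFDerivAt).comp_hasDerivAt τ hl

/-- Right translations along the flow of a left-invariant field commute with the derivative along
the field. -/
lemma fderiv_comp_mul_smul {φ : Heis n → ℝ} (hφ : ContDiff ℝ ∞ φ) (w p : Heis n) (τ : ℝ) :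
    fderiv ℝ (fun q => φ (mul q (τ • w))) p (lvf w p) =
      fderiv ℝ φ (mul p (τ • w)) (lvf w p) := by
  have hφ' : ContDiff ℝ ∞ fun q => φ (mul q (τ • w)) := hφ.comp (by fun_prop)
  have h1 := hasDerivAt_comp_mul_smul hφ' w p 0
  have h2 := hasDerivAt_comp_mul_smul hφ w p τ
  have h3 : HasDerivAt (fun σ : ℝ => φ (mul p ((σ + τ) • w)))
      (fderiv ℝ φ (mul p (τ • w)) (lvf w p)) 0 := by
    have := HasDerivAt.comp_add_const (0 : ℝ) τ (f := fun σ : ℝ => φ (mul p (σ • w))) (by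
      rw [zero_add]; exact h2)
    exact this
  simp only [mul_assoc', mul_smul_smul] at h1
  have := h1.unique h3
  simpa using this

/-- The fundamental theorem of calculus along the flow of a left-invariant field, for functions
with a distributional derivative along that field. -/
theorem HasWeakDeriv.ae_mul_sub_eq_integral {s : ℝ≥0∞} (hs1 : 1 ≤ s) (hs : s ≠ ⊤) {w : Heis n}
    {F G : Heis n → ℝ} (hF : MemLp F s volume) (hG : MemLp G s volume)
    (h : HasWeakDeriv Ω (lvf w) F G) (hA : IsOpen A)
    (hmem : ∀ p ∈ A, ∀ τ ∈ Set.Icc (0 : ℝ) 1, mul p (τ • w) ∈ Ω) :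
    ∀ᵐ p ∂(volume.restrict A),
      F (mul p w) - F p = ∫ τ in Set.Icc (0 : ℝ) 1, G (mul p (τ • w)) := by
  have hFl : LocallyIntegrable F volume := hF.locallyIntegrable hs1
  have hGl : LocallyIntegrable G volume := hG.locallyIntegrable hs1
  have hGm : AEStronglyMeasurable (Function.uncurry fun (τ : ℝ) (p : Heis n) => G (mul p (τ • w)))
      ((volume.restrict (Set.Icc (0 : ℝ) 1)).prod volume) :=
    aestronglyMeasurable_comp_mul_smul hG.1 w
  have hI : MemLp (fun p => ∫ τ in Set.Icc (0 : ℝ) 1, G (mul p (τ • w))) s volume := by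
    refine ⟨hGm.prod_swap.integral_prod_right', lt_of_le_of_lt
      (eLpNorm_integral_le_of_forall_le hs1 hs hGm (C := eLpNorm G s volume)
        (ae_of_all _ fun τ => (eLpNorm_comp_mul hG.1 _).le)) hG.2⟩
  have hT : MemLp (fun p => F (mul p w)) s volume := memLp_comp_mul hF w
  -- It suffices to test the identity against smooth functions with compact support in `A`.
  have key := hA.ae_eq_zero_of_integral_contDiff_smul_eq_zero (μ := volume)
    (f := fun p => F (mul p w) - F p - ∫ τ in Set.Icc (0 : ℝ) 1, G (mul p (τ • w)))
    ((((hT.sub hF).sub hI).locallyIntegrable hs1).locallyIntegrableOn A) ?_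
  · refine (ae_restrict_iff' hA.measurableSet).2 ?_
    filter_upwards [key] with p hp hpA
    exact sub_eq_zero.1 (hp hpA)
  intro φ h1 h2 h3
  set ν : Measure ℝ := volume.restrict (Set.Icc (0 : ℝ) 1) with hν
  -- A compact set containing the supports of all the translates `p ↦ φ (p · (-τ w))`, `τ ∈ [0, 1]`.
  set K : Set (Heis n) := (fun z : ℝ × Heis n => mul z.2 (z.1 • w)) ''
    (Set.Icc (0 : ℝ) 1 ×ˢ tsupport φ) with hK
  have hKc : IsCompact K := (isCompact_Icc.prod h2).image (by fun_prop)
  have hnotK : ∀ τ ∈ Set.Icc (0 : ℝ) 1, ∀ q ∉ K, mul q ((-τ) • w) ∉ tsupport φ := by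
    intro τ hτ q hq hmemφ
    refine hq ⟨(τ, mul q ((-τ) • w)), ⟨hτ, hmemφ⟩, ?_⟩
    simp only [mul_assoc', mul_smul_smul, neg_add_cancel, zero_smul, mul_zero_right]
  have hD1 : Continuous fun z : ℝ × Heis n => φ (mul z.2 ((-z.1) • w)) :=
    h1.continuous.comp (by fun_prop)
  have hD2 : Continuous fun z : ℝ × Heis n =>
      fderiv ℝ φ (mul z.2 ((-z.1) • w)) (lvf w z.2) := by
    have : Continuous (fderiv ℝ φ) := h1.continuous_fderiv (by simp)
    exact (this.comp (by fun_prop)).clm_apply (by fun_prop)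
  have hint1 : Integrable (fun z : ℝ × Heis n => G z.2 * φ (mul z.2 ((-z.1) • w)))
      (ν.prod volume) := by
    refine integrable_mul_prod_of_compact hGl hD1 hKc fun τ hτ q hq => ?_
    exact image_eq_zero_of_notMem_tsupport (hnotK τ hτ q hq)
  have hint2 : Integrable (fun z : ℝ × Heis n =>
      F z.2 * fderiv ℝ φ (mul z.2 ((-z.1) • w)) (lvf w z.2)) (ν.prod volume) := by
    refine integrable_mul_prod_of_compact hFl hD2 hKc fun τ hτ q hq => ?_
    have : fderiv ℝ φ (mul q ((-τ) • w)) = 0 := by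
      have hx := hnotK τ hτ q hq
      exact image_eq_zero_of_notMem_tsupport fun hy => hx (tsupport_fderiv_subset ℝ hy)
    rw [this]
    rfl
  have hint3 : Integrable (fun z : ℝ × Heis n => G (mul z.2 (z.1 • w)) * φ z.2)
      (ν.prod volume) := by
    have := (measurePreserving_prod_mul_smul ν w).integrable_comp_of_integrable hint1
    refine this.congr (ae_of_all _ fun z => ?_)
    simp only [Function.comp, mul_assoc', mul_smul_smul, add_neg_cancel, zero_smul, mul_zero_right]
  have iT := hT.locallyIntegrable hs1
  have i1 := integrable_mul_of_tsupport_subset (Ω := Set.univ) (iT.locallyIntegrableOn _)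
    h1.continuous h2 (Set.subset_univ _)
  have i2 := integrable_mul_of_tsupport_subset (Ω := Set.univ) (hFl.locallyIntegrableOn _)
    h1.continuous h2 (Set.subset_univ _)
  have i3 := integrable_mul_of_tsupport_subset (Ω := Set.univ)
    ((hI.locallyIntegrable hs1).locallyIntegrableOn _) h1.continuous h2 (Set.subset_univ _)
  have hφw : HasCompactSupport fun p => φ (mul p (-w)) := h2.comp_homeomorph (mulRight (-w))
  have hφws : ContDiff ℝ ∞ fun p => φ (mul p (-w)) := h1.comp (by fun_prop)
  have i4 := integrable_mul_of_tsupport_subset (Ω := Set.univ) (hFl.locallyIntegrableOn _)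
    hφws.continuous hφw (Set.subset_univ _)
  -- By invariance of the measure the translation passes to the test function, where the classical
  -- fundamental theorem applies (`e2`).
  have e1 : ∫ p, F (mul p w) * φ p = ∫ p, F p * φ (mul p (-w)) := by
    rw [← integral_comp_mulRight w fun p => F p * φ (mul p (-w))]
    simp only [mul_assoc', mul_neg_self, mul_zero_right]
  have e2 : ∀ p, φ (mul p (-w)) - φ p =
      -∫ τ, fderiv ℝ φ (mul p ((-τ) • w)) (lvf w p) ∂ν := by
    intro p
    have hd : ∀ τ ∈ Set.uIcc (0 : ℝ) 1, HasDerivAt (fun σ : ℝ => φ (mul p ((-σ) • w)))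
        (-fderiv ℝ φ (mul p ((-τ) • w)) (lvf w p)) τ := fun τ _ => by
      have := (hasDerivAt_comp_mul_smul h1 w p (-τ)).scomp τ (hasDerivAt_neg τ)
      rw [neg_one_smul] at this
      exact this
    have hc : Continuous fun τ : ℝ => fderiv ℝ φ (mul p ((-τ) • w)) (lvf w p) :=
      hD2.comp (by fun_prop : Continuous fun τ : ℝ => (τ, p))
    have := intervalIntegral.integral_eq_sub_of_hasDerivAt hd
      (hc.neg.intervalIntegrable 0 1)
    rw [hν, integral_Icc_eq_integral_Ioc, ← intervalIntegral.integral_of_le zero_le_one,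
      ← intervalIntegral.integral_neg, this]
    simp
  -- The weak derivative is tested with `φ` translated by `-τ w`; its support is that of `φ` moved
  -- along the flow, which `hmem` keeps in `Ω`. Differentiation along the field commutes with this
  -- translation.
  have e3 : ∀ τ ∈ Set.Icc (0 : ℝ) 1,
      ∫ p, F p * fderiv ℝ φ (mul p ((-τ) • w)) (lvf w p) =
        -∫ p, G (mul p (τ • w)) * φ p := by
    intro τ hτ
    set ψ : Heis n → ℝ := fun p => φ (mul p ((-τ) • w)) with hψ
    have p1 : ContDiff ℝ ∞ ψ := h1.comp (by fun_prop)
    have p2 : HasCompactSupport ψ := h2.comp_homeomorph (mulRight ((-τ) • w))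
    have p3 : tsupport ψ ⊆ Ω := by
      have : tsupport ψ = mulRight ((-τ) • w) ⁻¹' tsupport φ :=
        tsupport_comp_eq_preimage φ (mulRight ((-τ) • w))
      rw [this]
      intro q hq
      have := hmem _ (h3 hq) τ hτ
      simpa only [mulRight_apply, mul_assoc', mul_smul_smul, neg_add_cancel, zero_smul,
        mul_zero_right] using this
    have hw := h.2.2 ψ p1 p2 p3
    rw [setIntegral_mul_eq ((tsupport_fderiv_lvf_subset ψ w).trans p3),
      setIntegral_mul_eq p3] at hw
    simp only [hψ, fderiv_comp_mul_smul h1] at hw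
    rw [hw, ← integral_comp_mulRight (τ • w) fun p => G p * φ (mul p ((-τ) • w))]
    simp only [mul_assoc', mul_smul_smul, add_neg_cancel, zero_smul, mul_zero_right]
  have e4 : ∫ p, F p * ∫ τ, fderiv ℝ φ (mul p ((-τ) • w)) (lvf w p) ∂ν =
      -∫ p, (∫ τ, G (mul p (τ • w)) ∂ν) * φ p := by
    calc ∫ p, F p * ∫ τ, fderiv ℝ φ (mul p ((-τ) • w)) (lvf w p) ∂ν
        = ∫ p, (∫ τ, F p * fderiv ℝ φ (mul p ((-τ) • w)) (lvf w p) ∂ν) := by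
          simp only [integral_const_mul]
      _ = ∫ τ, (∫ p, F p * fderiv ℝ φ (mul p ((-τ) • w)) (lvf w p)) ∂ν :=
          (integral_integral_swap hint2).symm
      _ = ∫ τ, (-∫ p, G (mul p (τ • w)) * φ p) ∂ν :=
          setIntegral_congr_fun measurableSet_Icc e3
      _ = -∫ p, ∫ τ, G (mul p (τ • w)) * φ p ∂ν := by
          rw [integral_neg, integral_integral_swap hint3]
      _ = -∫ p, (∫ τ, G (mul p (τ • w)) ∂ν) * φ p := by
          simp only [integral_mul_const]
  have e5 : (∫ p, F p * φ (mul p (-w))) - ∫ p, F p * φ p =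
      ∫ p, (∫ τ, G (mul p (τ • w)) ∂ν) * φ p := by
    rw [← integral_sub i4 i2]
    simp only [← mul_sub, e2, mul_neg, integral_neg, e4, neg_neg]
  have e6 : (fun p => φ p • (F (mul p w) - F p - ∫ τ, G (mul p (τ • w)) ∂ν)) =
      fun p => F (mul p w) * φ p - F p * φ p - (∫ τ, G (mul p (τ • w)) ∂ν) * φ p := by
    funext p
    rw [smul_eq_mul]
    ring
  rw [e6, integral_sub (by exact i1.sub i2) i3, integral_sub i1 i2, e1, e5, sub_self]

end Heis

/-! ### `L^s` estimates of first- and second-order Taylor remainders. -/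

namespace Heis

variable {n : ℕ} {Ω A : Set (Heis n)} {s : ℝ≥0∞} {w : Heis n} {F G H : Heis n → ℝ}

/-- A function in `L^s` is integrable along almost every orbit of a left-invariant field. -/
lemma ae_integrable_mul_smul (hs1 : 1 ≤ s) (hs : s ≠ ⊤) (hG : MemLp G s volume) (w : Heis n) :
    ∀ᵐ p : Heis n, Integrable (fun τ : ℝ => G (mul p (τ • w)))
      (volume.restrict (Set.Icc (0 : ℝ) 1)) := by
  have hs0 : s ≠ 0 := (one_pos.trans_le hs1).ne'
  set ν : Measure ℝ := volume.restrict (Set.Icc (0 : ℝ) 1) with hν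
  have hGm := (aestronglyMeasurable_comp_mul_smul (ν := ν) hG.1 w).prod_swap
  have hm := hGm.enorm.pow_const s.toReal
  have hsw : ∫⁻ p : Heis n, ∫⁻ τ, ‖G (mul p (τ • w))‖ₑ ^ s.toReal ∂ν =
      eLpNorm G s volume ^ s.toReal := by
    rw [lintegral_lintegral_swap hm]
    simp only [← eLpNorm_rpow_toReal hs0 hs, eLpNorm_comp_mul hG.1]
    simp
  have hfin : ∀ᵐ p : Heis n, ∫⁻ τ, ‖G (mul p (τ • w))‖ₑ ^ s.toReal ∂ν < ⊤ := by
    refine ae_lt_top' hm.lintegral_prod_right' ?_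
    refine ne_of_eq_of_ne hsw (ENNReal.rpow_ne_top_of_nonneg ENNReal.toReal_nonneg hG.2.ne)
  filter_upwards [hfin, hGm.prodMk_left] with p hp hpm
  have : MemLp (fun τ : ℝ => G (mul p (τ • w))) s ν :=
    ⟨hpm, (eLpNorm_lt_top_iff_lintegral_rpow_enorm_lt_top hs0 hs).2 hp⟩
  exact this.integrable hs1

/-- Estimate of a remainder of the fundamental theorem of calculus by averaging. -/
lemma HasWeakDeriv.eLpNorm_remainder_le (hs1 : 1 ≤ s) (hs : s ≠ ⊤) (hF : MemLp F s volume)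
    (hG : MemLp G s volume) (h : HasWeakDeriv Ω (lvf w) F G) (hA : IsOpen A)
    (hmem : ∀ p ∈ A, ∀ τ ∈ Set.Icc (0 : ℝ) 1, mul p (τ • w) ∈ Ω) {P Q : Heis n → ℝ}
    (hP : AEStronglyMeasurable P volume) (hQ : AEStronglyMeasurable Q volume) {C : ℝ≥0∞}
    (hC : ∀ τ ∈ Set.Icc (0 : ℝ) 1,
      eLpNorm (fun p => G (mul p (τ • w)) - P p - τ * Q p) s (volume.restrict A) ≤ C) :
    eLpNorm (fun p => F (mul p w) - F p - P p - 1 / 2 * Q p) s (volume.restrict A) ≤ C := by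
  have hK : AEStronglyMeasurable
      (Function.uncurry fun (τ : ℝ) (p : Heis n) => G (mul p (τ • w)) - P p - τ * Q p)
      ((volume.restrict (Set.Icc (0 : ℝ) 1)).prod (volume.restrict A)) := by
    have hfull : AEStronglyMeasurable
        (Function.uncurry fun (τ : ℝ) (p : Heis n) => G (mul p (τ • w)) - P p - τ * Q p)
        ((volume.restrict (Set.Icc (0 : ℝ) 1)).prod volume) :=
      ((aestronglyMeasurable_comp_mul_smul hG.1 w).sub hP.comp_snd).sub
        (continuous_fst.aestronglyMeasurable.mul hQ.comp_snd)
    exact hfull.mono_measure (Measure.prod_mono le_rfl Measure.restrict_le_self)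
  have hmain := eLpNorm_integral_le_of_forall_le hs1 hs hK
    ((ae_restrict_iff' measurableSet_Icc).2 (ae_of_all _ hC))
  refine le_trans (le_of_eq (eLpNorm_congr_ae ?_)) hmain
  filter_upwards [h.ae_mul_sub_eq_integral hs1 hs hF hG hA hmem,
    ae_restrict_of_ae (ae_integrable_mul_smul hs1 hs hG w)] with p h1 h2
  have h3 : Integrable (fun τ : ℝ => τ * Q p) (volume.restrict (Set.Icc (0 : ℝ) 1)) :=
    (Continuous.integrableOn_Icc (by fun_prop) : IntegrableOn (fun τ : ℝ => τ * Q p) _ _)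
  -- The mean of `τ` over `[0, 1]` is the Taylor coefficient `1 / 2`.
  have h4 : ∫ τ in Set.Icc (0 : ℝ) 1, τ * Q p = 1 / 2 * Q p := by
    rw [integral_mul_const, integral_Icc_eq_integral_Ioc,
      ← intervalIntegral.integral_of_le zero_le_one, integral_id]
    norm_num
  rw [integral_sub (by exact h2.sub (integrable_const _)) h3, integral_sub h2 (integrable_const _), h4, h1]
  simp

lemma HasWeakDeriv.eLpNorm_mul_sub_le (hs1 : 1 ≤ s) (hs : s ≠ ⊤) (hF : MemLp F s volume)
    (hG : MemLp G s volume) (h : HasWeakDeriv Ω (lvf w) F G) (hA : IsOpen A)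
    (hmem : ∀ p ∈ A, ∀ τ ∈ Set.Icc (0 : ℝ) 1, mul p (τ • w) ∈ Ω) :
    eLpNorm (fun p => F (mul p w) - F p) s (volume.restrict A) ≤ eLpNorm G s volume := by
  have := h.eLpNorm_remainder_le hs1 hs hF hG hA hmem (P := 0) (Q := 0)
    aestronglyMeasurable_zero aestronglyMeasurable_zero (C := eLpNorm G s volume) fun τ _ => by
      simp only [Pi.zero_apply, sub_zero, mul_zero]
      exact (eLpNorm_mono_measure _ Measure.restrict_le_self).trans (eLpNorm_comp_mul hG.1 _).le
  simpa using this

lemma HasWeakDeriv.eLpNorm_mul_sub_sub_le (hs1 : 1 ≤ s) (hs : s ≠ ⊤) (hF : MemLp F s volume)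
    (hG : MemLp G s volume) (h : HasWeakDeriv Ω (lvf w) F G) (hA : IsOpen A)
    (hmem : ∀ p ∈ A, ∀ τ ∈ Set.Icc (0 : ℝ) 1, mul p (τ • w) ∈ Ω) {C : ℝ≥0∞}
    (hC : ∀ τ ∈ Set.Icc (0 : ℝ) 1,
      eLpNorm (fun p => G (mul p (τ • w)) - G p) s (volume.restrict A) ≤ C) :
    eLpNorm (fun p => F (mul p w) - F p - G p) s (volume.restrict A) ≤ C := by
  have := h.eLpNorm_remainder_le hs1 hs hF hG hA hmem (P := G) (Q := 0)
    hG.1 aestronglyMeasurable_zero (C := C) fun τ hτ => by simpa using hC τ hτ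
  simpa using this

lemma mem_of_smul_smul (hmem : ∀ p ∈ A, ∀ τ ∈ Set.Icc (0 : ℝ) 1, mul p (τ • w) ∈ Ω) {τ : ℝ}
    (hτ : τ ∈ Set.Icc (0 : ℝ) 1) :
    ∀ p ∈ A, ∀ σ ∈ Set.Icc (0 : ℝ) 1, mul p (σ • τ • w) ∈ Ω := by
  intro p hp σ hσ
  rw [smul_smul]
  exact hmem p hp _ ⟨mul_nonneg hσ.1 hτ.1, mul_le_one₀ hσ.2 hτ.1 hτ.2⟩

lemma eLpNorm_const_mul_le {X : Type*} [MeasurableSpace X] {μ : Measure X} {g : X → ℝ} {τ : ℝ}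
    (hτ : τ ∈ Set.Icc (0 : ℝ) 1) {C : ℝ≥0∞} (hg : eLpNorm g s μ ≤ C) :
    eLpNorm (fun x => τ * g x) s μ ≤ C := by
  refine le_trans (eLpNorm_mono fun x => ?_) hg
  rw [norm_mul, Real.norm_of_nonneg hτ.1]
  exact mul_le_of_le_one_left (norm_nonneg _) hτ.2

/-- The remainder is an average of the increments of `G` along `τ • w`; the derivative of `G` along
that field is `τ * H`, with `τ ≤ 1`. Bounding `τ` by 1 gives up the factor `1 / 2`. -/
lemma HasWeakDeriv.eLpNorm_second_order_le (hs1 : 1 ≤ s) (hs : s ≠ ⊤) (hF : MemLp F s volume)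
    (hG : MemLp G s volume) (hH : MemLp H s volume) (hFG : HasWeakDeriv Ω (lvf w) F G)
    (hGH : HasWeakDeriv Ω (lvf w) G H) (hA : IsOpen A)
    (hmem : ∀ p ∈ A, ∀ τ ∈ Set.Icc (0 : ℝ) 1, mul p (τ • w) ∈ Ω) :
    eLpNorm (fun p => F (mul p w) - F p - G p) s (volume.restrict A) ≤ eLpNorm H s volume :=
  hFG.eLpNorm_mul_sub_sub_le hs1 hs hF hG hA hmem fun τ hτ =>
    ((hGH.smul_field τ).eLpNorm_mul_sub_le hs1 hs hG (hH.const_mul τ) hA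
      (mem_of_smul_smul hmem hτ)).trans (eLpNorm_const_mul_le hτ le_rfl)

/-- Here the linear part `τ * H p` of the increment of `G` is subtracted before averaging, so that
only the oscillation of `H` along the path remains. -/
lemma HasWeakDeriv.eLpNorm_second_order_sub_le (hs1 : 1 ≤ s) (hs : s ≠ ⊤)
    (hF : MemLp F s volume) (hG : MemLp G s volume) (hH : MemLp H s volume)
    (hFG : HasWeakDeriv Ω (lvf w) F G) (hGH : HasWeakDeriv Ω (lvf w) G H) (hA : IsOpen A)
    (hmem : ∀ p ∈ A, ∀ τ ∈ Set.Icc (0 : ℝ) 1, mul p (τ • w) ∈ Ω) {C : ℝ≥0∞}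
    (hC : ∀ τ ∈ Set.Icc (0 : ℝ) 1, eLpNorm (fun p => H (mul p (τ • w)) - H p) s volume ≤ C) :
    eLpNorm (fun p => F (mul p w) - F p - G p - 1 / 2 * H p) s (volume.restrict A) ≤ C := by
  refine hFG.eLpNorm_remainder_le hs1 hs hF hG hA hmem hG.1 hH.1 fun τ hτ => ?_
  refine (hGH.smul_field τ).eLpNorm_mul_sub_sub_le hs1 hs hG (hH.const_mul τ) hA
    (mem_of_smul_smul hmem hτ) fun σ hσ => ?_
  simp only [← mul_sub, smul_smul]
  exact eLpNorm_const_mul_le hτ ((eLpNorm_mono_measure _ Measure.restrict_le_self).trans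
    (hC _ ⟨mul_nonneg hσ.1 hτ.1, mul_le_one₀ hσ.2 hτ.1 hτ.2⟩))

/-- Change of variables by a right translation. -/
lemma eLpNorm_comp_mul_restrict {k : Heis n → ℝ} (hk : AEStronglyMeasurable k volume)
    (a : Heis n) (A : Set (Heis n)) (hA : MeasurableSet A) :
    eLpNorm (fun p => k (mul p a)) s (volume.restrict A) =
      eLpNorm k s (volume.restrict (mulRight (-a) ⁻¹' A)) := by
  have hpre : mulRight a ⁻¹' (mulRight (-a) ⁻¹' A) = A := by
    ext p
    simp [mul_assoc']
  have hmp := (measurePreserving_mulRight a).restrict_preimage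
    ((mulRight (-a)).measurable hA)
  rw [hpre] at hmp
  exact eLpNorm_comp_measurePreserving hk.restrict hmp

end Heis

/-! ### Sobolev functions on `Ω`: paths inside `Ω`, gradient, Hessian and `T f`. -/

namespace Heis

variable {n : ℕ} {Ω A : Set (Heis n)} {s : ℝ≥0∞} {f : Heis n → ℝ}

/-- Points reached from `A` along a horizontal segment stay in `Ω`. -/
lemma mul_smul_horizontal_mem (hn : 1 ≤ n) (hΩ : IsOpen Ω) (hAΩ : A ⊆ Ω)
    {u : EuclideanSpace ℝ (Fin n ⊕ Fin n)} {t : ℝ}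
    (hut : ENNReal.ofReal (‖u‖ + 2 * √|t|) < ccSetDist A (frontier Ω)) :
    ∀ p ∈ A, ∀ τ ∈ Set.Icc (0 : ℝ) 1, mul p (τ • ((u, 0) : Heis n)) ∈ Ω := by
  intro p hp τ hτ
  refine mem_of_ccDist_lt hΩ hp (c := fun r => mul p (r • ((u, 0) : Heis n))) (by fun_prop)
    (by simpa using hAΩ hp) (fun r hr => ?_) hτ
  have h := ccDist_mul_mul_le hn p (r • u) 0
  have e : mul (mul p (r • u, 0)) (0, 0) = mul p (r • ((u, 0) : Heis n)) := by
    rw [show ((0, 0) : Heis n) = 0 from rfl, mul_zero_right, Prod.smul_mk, smul_zero]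
  rw [e] at h
  refine lt_of_le_of_lt (h.trans (ENNReal.ofReal_le_ofReal ?_)) hut
  rw [norm_smul, Real.norm_of_nonneg hr.1, abs_zero, Real.sqrt_zero, mul_zero, add_zero]
  have h1 : r * ‖u‖ ≤ ‖u‖ := mul_le_of_le_one_left (norm_nonneg _) hr.2
  have h2 : 0 ≤ √|t| := Real.sqrt_nonneg _
  linarith

/-- Points reached from `A` along a horizontal segment followed by a vertical one stay in `Ω`. -/
lemma mul_mul_smul_vertical_mem (hn : 1 ≤ n) (hΩ : IsOpen Ω) (hAΩ : A ⊆ Ω)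
    {u : EuclideanSpace ℝ (Fin n ⊕ Fin n)} {t : ℝ}
    (hut : ENNReal.ofReal (‖u‖ + 2 * √|t|) < ccSetDist A (frontier Ω)) :
    ∀ p ∈ A, ∀ τ ∈ Set.Icc (0 : ℝ) 1, mul (mul p (u, 0)) (τ • ((0, t) : Heis n)) ∈ Ω := by
  intro p hp τ hτ
  refine mem_of_ccDist_lt hΩ hp (c := fun r => mul (mul p (u, 0)) (r • ((0, t) : Heis n)))
    (by fun_prop) ?_ (fun r hr => ?_) hτ
  · have := mul_smul_horizontal_mem hn hΩ hAΩ hut p hp 1 (by simp)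
    simpa using this
  have h := ccDist_mul_mul_le hn p u (r * t)
  rw [show ((0, r * t) : Heis n) = r • ((0, t) : Heis n) by simp] at h
  refine lt_of_le_of_lt (h.trans (ENNReal.ofReal_le_ofReal ?_)) hut
  have : √|r * t| ≤ √|t| := Real.sqrt_le_sqrt (by
    rw [abs_mul, abs_of_nonneg hr.1]
    exact mul_le_of_le_one_left (abs_nonneg _) hr.2)
  linarith

lemma MemSobolev.memLp {k : ℕ} (hf : MemSobolev Ω s k f) : MemLp f s (volume.restrict Ω) := by
  cases k with
  | zero => exact hf
  | succ k => exact hf.1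

lemma MemSobolev.hasWeakDeriv {k : ℕ} (hf : MemSobolev Ω s (k + 1) f) (i : Fin n ⊕ Fin n) :
    HasWeakDeriv Ω (Z i) f (weakDeriv Ω (Z i) f) := by
  obtain ⟨g, hg, -⟩ := hf.2 i
  exact hg.weakDeriv

lemma MemSobolev.congr_ae {k : ℕ} {g : Heis n → ℝ} (hf : MemSobolev Ω s k f)
    (h : f =ᵐ[volume.restrict Ω] g) : MemSobolev Ω s k g := by
  cases k with
  | zero => exact (memLp_congr_ae h).1 hf
  | succ k =>
    refine ⟨(memLp_congr_ae h).1 hf.1, fun i => ?_⟩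
    obtain ⟨g', hg', hg''⟩ := hf.2 i
    exact ⟨g', hg'.congr_ae h (ae_eq_refl _), hg''⟩

/-- The definition only provides some derivative; by uniqueness the chosen representative inherits
its regularity, so derivatives can be iterated. -/
lemma MemSobolev.weakDeriv (hΩ : IsOpen Ω) {k : ℕ} (hf : MemSobolev Ω s (k + 1) f)
    (i : Fin n ⊕ Fin n) : MemSobolev Ω s k (weakDeriv Ω (Z i) f) := by
  obtain ⟨g, hg, hgm⟩ := hf.2 i
  exact hgm.congr_ae (hg.ae_eq hΩ hg.weakDeriv)

lemma inner_hGrad (u : EuclideanSpace ℝ (Fin n ⊕ Fin n)) (p : Heis n) :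
    inner ℝ (hGrad Ω f p) u = ∑ i, u i * weakDeriv Ω (Z i) f p := by
  simp [hGrad, PiLp.inner_apply]

/-- The grouping exhibits the quadratic form as the derivative along `(u, 0)` of `∑ⱼ uⱼ Zⱼ f`; no
symmetry of `Zᵢ Zⱼ f` is needed. -/
lemma inner_hHess (u : EuclideanSpace ℝ (Fin n ⊕ Fin n)) (p : Heis n) :
    inner ℝ (hHess Ω f p u) u =
      ∑ j, u j * ∑ i, u i * weakDeriv Ω (Z i) (weakDeriv Ω (Z j) f) p := by
  have h1 : ∀ i, hHess Ω f p u i =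
      ∑ j, weakDeriv Ω (Z i) (weakDeriv Ω (Z j) f) p * u j := by
    intro i
    simp [hHess, Matrix.ofLp_toEuclideanCLM, Matrix.mulVec, dotProduct]
  rw [PiLp.inner_apply]
  simp only [h1, RCLike.inner_apply, conj_trivial, Finset.mul_sum]
  rw [Finset.sum_comm]
  exact Finset.sum_congr rfl fun _ _ => Finset.sum_congr rfl fun _ _ => by ring

lemma memLp_sum_mul {ι : Type*} (I : Finset ι) (u : ι → ℝ) {g : ι → Heis n → ℝ}
    {μ : Measure (Heis n)} (hg : ∀ i, MemLp (g i) s μ) : MemLp (fun p => ∑ i ∈ I, u i * g i p) s μ :=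
  memLp_finsetSum I fun i _ => (hg i).const_mul (u i)

lemma memLp_inner_hGrad (hΩ : IsOpen Ω) (hf : MemSobolev Ω s 2 f)
    (u : EuclideanSpace ℝ (Fin n ⊕ Fin n)) :
    MemLp (fun p => inner ℝ (hGrad Ω f p) u) s (volume.restrict Ω) := by
  simp only [inner_hGrad]
  exact memLp_sum_mul _ _ fun i => (hf.weakDeriv hΩ i).memLp

lemma memLp_inner_hHess (hΩ : IsOpen Ω) (hf : MemSobolev Ω s 2 f)
    (u : EuclideanSpace ℝ (Fin n ⊕ Fin n)) :
    MemLp (fun p => inner ℝ (hHess Ω f p u) u) s (volume.restrict Ω) := by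
  simp only [inner_hHess]
  exact memLp_sum_mul _ _ fun j => memLp_sum_mul _ _ fun i =>
    ((hf.weakDeriv hΩ j).weakDeriv hΩ i).memLp

lemma MemSobolev.hasWeakDeriv_inner_hGrad (hs1 : 1 ≤ s) (hf : MemSobolev Ω s 2 f)
    (u : EuclideanSpace ℝ (Fin n ⊕ Fin n)) :
    HasWeakDeriv Ω (lvf (u, 0)) f fun p => inner ℝ (hGrad Ω f p) u := by
  simp only [inner_hGrad]
  exact hasWeakDeriv_lvf_horizontal (locallyIntegrableOn_of_locallyIntegrable_restrict
    (hf.memLp.locallyIntegrable hs1)) hf.hasWeakDeriv u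

lemma MemSobolev.hasWeakDeriv_inner_hHess (hΩ : IsOpen Ω) (hf : MemSobolev Ω s 2 f)
    (u : EuclideanSpace ℝ (Fin n ⊕ Fin n)) :
    HasWeakDeriv Ω (lvf (u, 0)) (fun p => inner ℝ (hGrad Ω f p) u)
      fun p => inner ℝ (hHess Ω f p u) u := by
  simp only [inner_hGrad, inner_hHess]
  exact hasWeakDeriv_sum_mul (fun j => hasWeakDeriv_lvf_horizontal (hf.hasWeakDeriv j).2.1
    (fun i => (hf.weakDeriv hΩ j).hasWeakDeriv i) u) u

/-- The vertical derivative of a function in `W^{2,s}` exists and is in `L^s`. -/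
lemma MemSobolev.vertical (hn : 1 ≤ n) (hΩ : IsOpen Ω) (hf : MemSobolev Ω s 2 f) :
    HasWeakDeriv Ω T f (Heis.weakDeriv Ω T f) ∧
      MemLp (Heis.weakDeriv Ω T f) s (volume.restrict Ω) := by
  have h := hasWeakDeriv_T ⟨0, hn⟩ (hf.hasWeakDeriv _) (hf.hasWeakDeriv _)
    ((hf.weakDeriv hΩ (Sum.inl ⟨0, hn⟩)).hasWeakDeriv (Sum.inr ⟨0, hn⟩))
    ((hf.weakDeriv hΩ (Sum.inr ⟨0, hn⟩)).hasWeakDeriv (Sum.inl ⟨0, hn⟩))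
  refine ⟨h.weakDeriv, (memLp_congr_ae (h.ae_eq hΩ h.weakDeriv)).1 (MemLp.const_mul ?_ _)⟩
  exact ((hf.weakDeriv hΩ _).weakDeriv hΩ _).memLp.sub ((hf.weakDeriv hΩ _).weakDeriv hΩ _).memLp

lemma eLpNorm_inner_hHess_le (u : EuclideanSpace ℝ (Fin n ⊕ Fin n)) :
    eLpNorm (fun p => inner ℝ (hHess Ω f p u) u) s (volume.restrict Ω) ≤
      ENNReal.ofReal (‖u‖ ^ 2) * eLpNorm (fun p => ‖hHess Ω f p‖) s (volume.restrict Ω) := by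
  rw [← Real.enorm_eq_ofReal (by positivity), ← eLpNorm_const_smul]
  refine eLpNorm_mono fun p => ?_
  rw [Pi.smul_apply, norm_smul, norm_norm, Real.norm_of_nonneg (by positivity : 0 ≤ ‖u‖ ^ 2)]
  calc ‖inner ℝ (hHess Ω f p u) u‖ ≤ ‖hHess Ω f p u‖ * ‖u‖ := norm_inner_le_norm _ _
    _ ≤ ‖hHess Ω f p‖ * ‖u‖ * ‖u‖ := by gcongr; exact ContinuousLinearMap.le_opNorm _ _
    _ = ‖u‖ ^ 2 * ‖hHess Ω f p‖ := by ring

/-- Extension by zero creates no boundary term, since test functions are supported in `Ω`. It yields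
functions in `L^s` of the whole space, where translations act. -/
lemma HasWeakDeriv.indicator (hΩ : IsOpen Ω) {V : Heis n → Heis n} {f g : Heis n → ℝ}
    (h : HasWeakDeriv Ω V f g) : HasWeakDeriv Ω V (Ω.indicator f) (Ω.indicator g) :=
  h.congr_ae (indicator_ae_eq_restrict hΩ.measurableSet).symm
    (indicator_ae_eq_restrict hΩ.measurableSet).symm

/-! ### Increments along a horizontal step followed by a vertical one. -/

section Increments

variable {F G H W : Heis n → ℝ} {u : EuclideanSpace ℝ (Fin n ⊕ Fin n)} {t : ℝ}

lemma mul_mul_horizontal_vertical (p : Heis n) (u : EuclideanSpace ℝ (Fin n ⊕ Fin n)) (t : ℝ) :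
    mul (mul p (u, 0)) (0, t) = mul p (u, t) := by
  rw [mul_assoc']
  simp [mul_eq]

/-- The vertical step starts at `p · (u, 0)`, so its estimate is made on the right translate of `A`
by `(u, 0)` and then pulled back to `A`. -/
lemma mem_translate (hn : 1 ≤ n) (hΩ : IsOpen Ω) (hAΩ : A ⊆ Ω)
    (hut : ENNReal.ofReal (‖u‖ + 2 * √|t|) < ccSetDist A (frontier Ω)) :
    ∀ q ∈ mulRight (-((u, 0) : Heis n)) ⁻¹' A, ∀ τ ∈ Set.Icc (0 : ℝ) 1,
      mul q (τ • ((0, t) : Heis n)) ∈ Ω := by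
  intro q hq τ hτ
  have := mul_mul_smul_vertical_mem hn hΩ hAΩ hut _ hq τ hτ
  rwa [mulRight_apply, mul_assoc' q, neg_mul_self, mul_zero_right] at this

/-- The vertical field `t T`. -/
lemma HasWeakDeriv.vertical (h : HasWeakDeriv Ω T F W) (t : ℝ) :
    HasWeakDeriv Ω (lvf (0, t)) F fun p => t * W p := by
  have hT : (T : Heis n → Heis n) = lvf (0, 1) := funext T_eq_lvf
  rw [hT] at h
  simpa using h.smul_field t

/-- Bound of the second-order increment. -/
theorem eLpNorm_increment_le (hn : 1 ≤ n) (hs1 : 1 ≤ s) (hs : s ≠ ⊤) (hΩ : IsOpen Ω)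
    (hA : IsOpen A) (hAΩ : A ⊆ Ω) (hF : MemLp F s volume) (hG : MemLp G s volume)
    (hH : MemLp H s volume) (hW : MemLp W s volume) (hFG : HasWeakDeriv Ω (lvf (u, 0)) F G)
    (hGH : HasWeakDeriv Ω (lvf (u, 0)) G H) (hFW : HasWeakDeriv Ω T F W)
    (hut : ENNReal.ofReal (‖u‖ + 2 * √|t|) < ccSetDist A (frontier Ω)) :
    eLpNorm (fun p => F (mul p (u, t)) - F p - G p) s (volume.restrict A) ≤
      ENNReal.ofReal |t| * eLpNorm W s volume + eLpNorm H s volume := by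
  have h1 := hFG.eLpNorm_second_order_le hs1 hs hF hG hH hGH hA
    (mul_smul_horizontal_mem hn hΩ hAΩ hut)
  have hmF := (memLp_comp_mul hF (0, t)).1
  have h2 := (hFW.vertical t).eLpNorm_mul_sub_le hs1 hs hF (hW.const_mul t)
    (hA.preimage (mulRight _).continuous) (mem_translate hn hΩ hAΩ hut)
  rw [← eLpNorm_comp_mul_restrict (k := fun p => F (mul p (0, t)) - F p) (hmF.sub hF.1) _ _
    hA.measurableSet] at h2
  simp only [mul_mul_horizontal_vertical] at h2
  have h3 : eLpNorm (fun p => t * W p) s volume = ENNReal.ofReal |t| * eLpNorm W s volume := by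
    rw [← Real.enorm_eq_ofReal_abs, ← eLpNorm_const_smul]
    rfl
  rw [h3] at h2
  have hm1 := (memLp_comp_mul hF (u, t)).1
  have hm2 := (memLp_comp_mul hF (u, 0)).1
  have e : (fun p => F (mul p (u, t)) - F p - G p) =
      (fun p => F (mul p (u, t)) - F (mul p (u, 0))) +
        fun p => F (mul p (u, 0)) - F p - G p := by
    funext p
    simp only [Pi.add_apply]
    ring
  rw [e]
  exact (eLpNorm_add_le (hm1.sub hm2).restrict ((hm2.sub hF.1).sub hG.1).restrict hs1).trans
    (add_le_add h2 h1)

/-- Approximation of the second-order increment by the second-order Taylor polynomial. -/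
theorem eLpNorm_increment_sub_le (hn : 1 ≤ n) (hs1 : 1 ≤ s) (hs : s ≠ ⊤) (hΩ : IsOpen Ω)
    (hA : IsOpen A) (hAΩ : A ⊆ Ω) (hF : MemLp F s volume) (hG : MemLp G s volume)
    (hH : MemLp H s volume) (hW : MemLp W s volume) (hFG : HasWeakDeriv Ω (lvf (u, 0)) F G)
    (hGH : HasWeakDeriv Ω (lvf (u, 0)) G H) (hFW : HasWeakDeriv Ω T F W)
    (hut : ENNReal.ofReal (‖u‖ + 2 * √|t|) < ccSetDist A (frontier Ω)) {C D : ℝ≥0∞}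
    (hC : ∀ τ ∈ Set.Icc (0 : ℝ) 1,
      eLpNorm (fun p => H (mul p (τ • ((u, 0) : Heis n))) - H p) s volume ≤ C)
    (hD : ∀ τ ∈ Set.Icc (0 : ℝ) 1,
      eLpNorm (fun p => W (mul p (τ • ((0, t) : Heis n))) - W p) s volume ≤ D)
    (hD' : eLpNorm (fun p => W (mul p (u, 0)) - W p) s volume ≤ D) :
    eLpNorm (fun p => F (mul p (u, t)) - F p - G p - (1 / 2 * H p + t * W p)) s
      (volume.restrict A) ≤ ENNReal.ofReal |t| * D + ENNReal.ofReal |t| * D + C := by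
  have hmul : ∀ (k : Heis n → ℝ) (μ : Measure (Heis n)),
      eLpNorm (fun p => t * k p) s μ = ENNReal.ofReal |t| * eLpNorm k s μ := by
    intro k μ
    rw [← Real.enorm_eq_ofReal_abs, ← eLpNorm_const_smul]
    rfl
  have h1 := hFG.eLpNorm_second_order_sub_le hs1 hs hF hG hH hGH hA
    (mul_smul_horizontal_mem hn hΩ hAΩ hut) hC
  have hmF := (memLp_comp_mul hF (0, t)).1
  have h2 := (hFW.vertical t).eLpNorm_mul_sub_sub_le hs1 hs hF (hW.const_mul t)
    (hA.preimage (mulRight _).continuous) (mem_translate hn hΩ hAΩ hut)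
    (C := ENNReal.ofReal |t| * D) (fun τ hτ => by
      simp only [← mul_sub]
      rw [hmul]
      gcongr
      exact (eLpNorm_mono_measure _ Measure.restrict_le_self).trans (hD τ hτ))
  rw [← eLpNorm_comp_mul_restrict (k := fun p => F (mul p (0, t)) - F p - t * W p)
    ((hmF.sub hF.1).sub (hW.1.const_mul t)) _ _ hA.measurableSet] at h2
  simp only [mul_mul_horizontal_vertical] at h2
  have h3 : eLpNorm (fun p => t * (W (mul p (u, 0)) - W p)) s (volume.restrict A) ≤
      ENNReal.ofReal |t| * D := by
    rw [hmul]
    gcongr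
    exact (eLpNorm_mono_measure _ Measure.restrict_le_self).trans hD'
  have hm1 := (memLp_comp_mul hF (u, t)).1
  have hm2 := (memLp_comp_mul hF (u, 0)).1
  have hm3 := (memLp_comp_mul hW (u, 0)).1
  -- Three errors: the vertical remainder based at `p · (u, 0)`, the change of `W` between that
  -- point and `p`, and the horizontal second-order remainder.
  have e : (fun p => F (mul p (u, t)) - F p - G p - (1 / 2 * H p + t * W p)) =
      ((fun p => F (mul p (u, t)) - F (mul p (u, 0)) - t * W (mul p (u, 0))) +
        fun p => t * (W (mul p (u, 0)) - W p)) +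
        fun p => F (mul p (u, 0)) - F p - G p - 1 / 2 * H p := by
    funext p
    simp only [Pi.add_apply]
    ring
  rw [e]
  have m1 : AEStronglyMeasurable
      (fun p => F (mul p (u, t)) - F (mul p (u, 0)) - t * W (mul p (u, 0)))
      (volume.restrict A) := ((hm1.sub hm2).sub (hm3.const_mul t)).restrict
  have m2 : AEStronglyMeasurable (fun p => t * (W (mul p (u, 0)) - W p)) (volume.restrict A) :=
    ((hm3.sub hW.1).const_mul t).restrict
  have m3 : AEStronglyMeasurable (fun p => F (mul p (u, 0)) - F p - G p - 1 / 2 * H p)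
      (volume.restrict A) :=
    (((hm2.sub hF.1).sub hG.1).sub (hH.1.const_mul (1 / 2))).restrict
  exact (eLpNorm_add_le (m1.add m2) m3 hs1).trans
    (add_le_add ((eLpNorm_add_le m1 m2 hs1).trans (add_le_add h2 h3)) h1)

end Increments

end Heis

/-! ### Rescaling by dilations: the bound and the limit. -/

namespace Heis

variable {n : ℕ} {Ω A : Set (Heis n)} {s : ℝ≥0∞} {f : Heis n → ℝ}

/-- The distance bound is homogeneous of degree 1 under dilations, whence the smallness condition on
`ε`. -/
lemma dil_dist_eq (w : Heis n) {ε : ℝ} (hε : 0 < ε) :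
    ‖ε • w.1‖ + 2 * √|ε ^ 2 * w.2| = ε * (‖w.1‖ + 2 * √|w.2|) := by
  rw [norm_smul, Real.norm_of_nonneg hε.le, abs_mul, abs_of_nonneg (sq_nonneg ε),
    Real.sqrt_mul (sq_nonneg ε), Real.sqrt_sq hε.le]
  ring

/-- On `A` the difference quotient involves only the values of `f` in `Ω`. -/
lemma diffQuot₂_eq_indicator (hn : 1 ≤ n) (hΩ : IsOpen Ω) (hAΩ : A ⊆ Ω) {w : Heis n} {ε : ℝ}
    (hε : 0 < ε)
    (hεw : ENNReal.ofReal (ε * (‖w.1‖ + 2 * √|w.2|)) < ccSetDist A (frontier Ω)) {p : Heis n}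
    (hp : p ∈ A) :
    diffQuot₂ Ω f w ε p = (ε ^ 2)⁻¹ * (Ω.indicator f (mul p (ε • w.1, ε ^ 2 * w.2)) -
      Ω.indicator f p - Ω.indicator (fun q => inner ℝ (hGrad Ω f q) (ε • w.1)) p) := by
  rw [← dil_dist_eq w hε] at hεw
  have hmem := mul_mul_smul_vertical_mem hn hΩ hAΩ hεw p hp 1 (by simp)
  rw [one_smul, mul_mul_horizontal_vertical] at hmem
  rw [Set.indicator_of_mem hmem, Set.indicator_of_mem (hAΩ hp), Set.indicator_of_mem (hAΩ hp),
    inner_smul_right, diffQuot₂, dil, div_eq_inv_mul]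

lemma eLpNorm_inv_sq_mul {μ : Measure (Heis n)} {ε : ℝ} (hε : 0 < ε) {k : Heis n → ℝ}
    {C : ℝ≥0∞} (hk : eLpNorm k s μ ≤ ENNReal.ofReal (ε ^ 2) * C) :
    eLpNorm (fun p => (ε ^ 2)⁻¹ * k p) s μ ≤ C := by
  have e : eLpNorm (fun p => (ε ^ 2)⁻¹ * k p) s μ = ENNReal.ofReal (ε ^ 2)⁻¹ * eLpNorm k s μ := by
    rw [← Real.enorm_eq_ofReal (by positivity), ← eLpNorm_const_smul]
    rfl
  rw [e]
  calc ENNReal.ofReal (ε ^ 2)⁻¹ * eLpNorm k s μ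
      ≤ ENNReal.ofReal (ε ^ 2)⁻¹ * (ENNReal.ofReal (ε ^ 2) * C) := by gcongr
    _ = C := by
        rw [← mul_assoc, ← ENNReal.ofReal_mul (by positivity),
          inv_mul_cancel₀ (by positivity), ENNReal.ofReal_one, one_mul]

/-- The difference quotient is bounded in `L^s`. -/
theorem memLp_diffQuot₂_and_eLpNorm_le (hn : 1 ≤ n) (hs1 : 1 ≤ s) (hs : s ≠ ⊤) (hΩ : IsOpen Ω)
    (hf : MemSobolev Ω s 2 f) (hA : IsOpen A) (hAΩ : A ⊆ Ω) (w : Heis n) {ε : ℝ} (hε : 0 < ε)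
    (hεw : ENNReal.ofReal (ε * (‖w.1‖ + 2 * √|w.2|)) < ccSetDist A (frontier Ω)) :
    MemLp (diffQuot₂ Ω f w ε) s (volume.restrict A) ∧
      eLpNorm (diffQuot₂ Ω f w ε) s (volume.restrict A) ≤
        ENNReal.ofReal |w.2| * eLpNorm (weakDeriv Ω T f) s (volume.restrict Ω) +
        ENNReal.ofReal (‖w.1‖ ^ 2) *
          eLpNorm (fun p => ‖hHess Ω f p‖) s (volume.restrict Ω) := by
  have hΩm := hΩ.measurableSet
  have hF := (memLp_indicator_iff_restrict hΩm).2 hf.memLp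
  have hG := (memLp_indicator_iff_restrict hΩm).2 (memLp_inner_hGrad hΩ hf (ε • w.1))
  have hH := (memLp_indicator_iff_restrict hΩm).2 (memLp_inner_hHess hΩ hf (ε • w.1))
  obtain ⟨hT, hTm⟩ := hf.vertical hn hΩ
  have hW := (memLp_indicator_iff_restrict hΩm).2 hTm
  have hae : ∀ᵐ p ∂(volume.restrict A), diffQuot₂ Ω f w ε p =
      (ε ^ 2)⁻¹ * (Ω.indicator f (mul p (ε • w.1, ε ^ 2 * w.2)) -
      Ω.indicator f p - Ω.indicator (fun q => inner ℝ (hGrad Ω f q) (ε • w.1)) p) :=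
    (ae_restrict_iff' hA.measurableSet).2
      (ae_of_all _ fun p hp => diffQuot₂_eq_indicator hn hΩ hAΩ hε hεw hp)
  constructor
  · refine (memLp_congr_ae hae).2 (MemLp.const_mul ?_ _)
    exact ((((memLp_comp_mul hF _).sub hF).sub hG).restrict A)
  · rw [eLpNorm_congr_ae hae]
    refine eLpNorm_inv_sq_mul hε ?_
    refine (eLpNorm_increment_le hn hs1 hs hΩ hA hAΩ hF hG hH hW
      ((hf.hasWeakDeriv_inner_hGrad hs1 _).indicator hΩ)
      ((hf.hasWeakDeriv_inner_hHess hΩ _).indicator hΩ) (hT.indicator hΩ)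
      (by rwa [dil_dist_eq w hε])).trans ?_
    rw [eLpNorm_indicator_eq_eLpNorm_restrict hΩm, eLpNorm_indicator_eq_eLpNorm_restrict hΩm,
      mul_add, abs_mul, abs_of_nonneg (sq_nonneg ε), ENNReal.ofReal_mul (sq_nonneg ε), mul_assoc,
      ← mul_assoc (ENNReal.ofReal (ε ^ 2)) (ENNReal.ofReal (‖w.1‖ ^ 2)),
      ← ENNReal.ofReal_mul (sq_nonneg ε)]
    refine add_le_add le_rfl ((eLpNorm_inner_hHess_le _).trans_eq ?_)
    rw [norm_smul, Real.norm_of_nonneg hε.le, mul_pow]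

/-- The difference quotient converges in `L^s`. -/
theorem tendsto_diffQuot₂ (hn : 1 ≤ n) (hs1 : 1 ≤ s) (hs : s ≠ ⊤) (hΩ : IsOpen Ω)
    (hf : MemSobolev Ω s 2 f) (hA : IsOpen A) (hAΩ : A ⊆ Ω)
    (hdist : 0 < ccSetDist A (frontier Ω)) (w : Heis n) :
    Tendsto (fun ε : ℝ => eLpNorm (fun p => diffQuot₂ Ω f w ε p -
      (1 / 2 * inner ℝ (hHess Ω f p w.1) w.1 + w.2 * weakDeriv Ω T f p))
      s (volume.restrict A)) (𝓝[>] 0) (𝓝 0) := by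
  have hΩm := hΩ.measurableSet
  have hF := (memLp_indicator_iff_restrict hΩm).2 hf.memLp
  have hH := (memLp_indicator_iff_restrict hΩm).2 (memLp_inner_hHess hΩ hf w.1)
  obtain ⟨hT, hTm⟩ := hf.vertical hn hΩ
  have hW := (memLp_indicator_iff_restrict hΩm).2 hTm
  rw [ENNReal.tendsto_nhds_zero]
  intro η hη
  -- After division by `ε ^ 2`, the two vertical errors cost `|w.2| * δ` each and the horizontal one
  -- costs `δ`.
  set c : ℝ≥0∞ := ENNReal.ofReal |w.2| + ENNReal.ofReal |w.2| + 1 with hc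
  have hctop : c ≠ ⊤ := by simp [hc]
  set δ : ℝ≥0∞ := η / c with hδ
  have hδ0 : 0 < δ := ENNReal.div_pos hη.ne' hctop
  have hev := (ENNReal.tendsto_nhds_zero.1 (tendsto_eLpNorm_mul_sub hs1 hs hH) δ hδ0).and
    (ENNReal.tendsto_nhds_zero.1 (tendsto_eLpNorm_mul_sub hs1 hs hW) δ hδ0)
  obtain ⟨r, hr, hball⟩ := Metric.eventually_nhds_iff_ball.1 hev
  have ha : ∀ᶠ ε : ℝ in 𝓝[>] 0, ‖((ε • w.1, 0) : Heis n)‖ < r := by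
    have : Tendsto (fun ε : ℝ => ‖((ε • w.1, 0) : Heis n)‖) (𝓝 0) (𝓝 0) :=
      (by fun_prop : Continuous fun ε : ℝ => ‖((ε • w.1, 0) : Heis n)‖).tendsto' _ _ (by simp)
    exact (this.mono_left nhdsWithin_le_nhds).eventually (gt_mem_nhds hr)
  have hb : ∀ᶠ ε : ℝ in 𝓝[>] 0, ‖((0, ε ^ 2 * w.2) : Heis n)‖ < r := by
    have : Tendsto (fun ε : ℝ => ‖((0, ε ^ 2 * w.2) : Heis n)‖) (𝓝 0) (𝓝 0) :=
      (by fun_prop : Continuous fun ε : ℝ => ‖((0, ε ^ 2 * w.2) : Heis n)‖).tendsto' _ _ (by simp)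
    exact (this.mono_left nhdsWithin_le_nhds).eventually (gt_mem_nhds hr)
  have hd : ∀ᶠ ε : ℝ in 𝓝[>] 0,
      ENNReal.ofReal (ε * (‖w.1‖ + 2 * √|w.2|)) < ccSetDist A (frontier Ω) := by
    have : Tendsto (fun ε : ℝ => ENNReal.ofReal (ε * (‖w.1‖ + 2 * √|w.2|))) (𝓝 0) (𝓝 0) :=
      (ENNReal.continuous_ofReal.comp (by fun_prop :
        Continuous fun ε : ℝ => ε * (‖w.1‖ + 2 * √|w.2|))).tendsto' _ _ (by simp)
    exact (this.mono_left nhdsWithin_le_nhds).eventually (gt_mem_nhds hdist)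
  filter_upwards [ha, hb, hd, self_mem_nhdsWithin] with ε hεa hεb hεw hε
  replace hε : 0 < ε := hε
  have hsmall : ∀ v : Heis n, ‖v‖ < r → ∀ τ ∈ Set.Icc (0 : ℝ) 1, τ • v ∈ Metric.ball 0 r := by
    intro v hv τ hτ
    rw [mem_ball_zero_iff, norm_smul, Real.norm_of_nonneg hτ.1]
    exact (mul_le_of_le_one_left (norm_nonneg _) hτ.2).trans_lt hv
  have hG := (memLp_indicator_iff_restrict hΩm).2 (memLp_inner_hGrad hΩ hf (ε • w.1))
  -- Quadratic homogeneity extracts `ε ^ 2`, so a single modulus of continuity, for the Hessian term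
  -- of `w.1`, serves all `ε`.
  have hquad : ∀ p, Ω.indicator (fun q => inner ℝ (hHess Ω f q (ε • w.1)) (ε • w.1)) p =
      ε ^ 2 * Ω.indicator (fun q => inner ℝ (hHess Ω f q w.1) w.1) p := by
    intro p
    by_cases hp : p ∈ Ω
    · simp only [Set.indicator_of_mem hp, map_smul, inner_smul_left, inner_smul_right,
        conj_trivial]
      ring
    · simp [Set.indicator_of_notMem hp]
  have hH' := (memLp_indicator_iff_restrict hΩm).2 (memLp_inner_hHess hΩ hf (ε • w.1))
  have main := eLpNorm_increment_sub_le hn hs1 hs hΩ hA hAΩ hF hG hH' hW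
      ((hf.hasWeakDeriv_inner_hGrad hs1 _).indicator hΩ)
      ((hf.hasWeakDeriv_inner_hHess hΩ _).indicator hΩ) (hT.indicator hΩ)
      (t := ε ^ 2 * w.2) (by rwa [dil_dist_eq w hε]) (C := ENNReal.ofReal (ε ^ 2) * δ) (D := δ)
      (fun τ hτ => by
        simp only [hquad, ← mul_sub]
        have e : ∀ k : Heis n → ℝ, eLpNorm (fun p => ε ^ 2 * k p) s volume =
            ENNReal.ofReal (ε ^ 2) * eLpNorm k s volume := fun k => by
          rw [← Real.enorm_eq_ofReal (sq_nonneg ε), ← eLpNorm_const_smul]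
          rfl
        rw [e]
        gcongr
        exact (hball _ (hsmall _ hεa τ hτ)).1)
      (fun τ hτ => (hball _ (hsmall _ hεb τ hτ)).2)
      (hball _ (by simpa using hsmall _ hεa 1 (by simp))).2
  have hbound : ENNReal.ofReal |ε ^ 2 * w.2| * δ + ENNReal.ofReal |ε ^ 2 * w.2| * δ +
      ENNReal.ofReal (ε ^ 2) * δ ≤ ENNReal.ofReal (ε ^ 2) * η := by
    rw [abs_mul, abs_of_nonneg (sq_nonneg ε), ENNReal.ofReal_mul (sq_nonneg ε)]
    calc _ = ENNReal.ofReal (ε ^ 2) * (c * δ) := by rw [hc]; ring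
      _ ≤ _ := by gcongr; exact ENNReal.mul_div_le
  refine le_trans (le_of_eq (eLpNorm_congr_ae ?_)) (eLpNorm_inv_sq_mul hε (main.trans hbound))
  refine (ae_restrict_iff' hA.measurableSet).2 (ae_of_all _ fun p hp => ?_)
  have hεne : ε ≠ 0 := hε.ne'
  simp only [diffQuot₂_eq_indicator hn hΩ hAΩ hε hεw hp, hquad]
  rw [Set.indicator_of_mem (hAΩ hp) (fun q => inner ℝ (hHess Ω f q w.1) w.1),
    Set.indicator_of_mem (hAΩ hp) (Heis.weakDeriv Ω T f)]
  field_simp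

end Heis

end

theorem mainTheorem4 {n : ℕ} (hn : 1 ≤ n) (s : ℝ≥0∞) (hs1 : 1 ≤ s) (hs : s ≠ ⊤)
    (Ω : Set (Heis n)) (hΩ : IsOpen Ω) (f : Heis n → ℝ) (hf : Heis.MemSobolev Ω s 2 f)
    (A : Set (Heis n)) (hA : IsOpen A) (hAΩ : A ⊆ Ω)
    (hdist : 0 < Heis.ccSetDist A (frontier Ω)) :
    (Heis.HasWeakDeriv Ω Heis.T f (Heis.weakDeriv Ω Heis.T f) ∧
      MemLp (Heis.weakDeriv Ω Heis.T f) s (volume.restrict Ω)) ∧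
    (∀ w : Heis n,
      MemLp (fun p => 1 / 2 * inner ℝ (Heis.hHess Ω f p w.1) w.1 +
        w.2 * Heis.weakDeriv Ω Heis.T f p) s (volume.restrict A) ∧
      Tendsto (fun ε : ℝ => eLpNorm (fun p => Heis.diffQuot₂ Ω f w ε p -
          (1 / 2 * inner ℝ (Heis.hHess Ω f p w.1) w.1 + w.2 * Heis.weakDeriv Ω Heis.T f p))
        s (volume.restrict A)) (𝓝[>] 0) (𝓝 0)) ∧
    (∀ (w : Heis n) (ε : ℝ), 0 < ε →
      ENNReal.ofReal (ε * (‖w.1‖ + 2 * √|w.2|)) < Heis.ccSetDist A (frontier Ω) →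
      MemLp (Heis.diffQuot₂ Ω f w ε) s (volume.restrict A) ∧
      eLpNorm (Heis.diffQuot₂ Ω f w ε) s (volume.restrict A) ≤
        ENNReal.ofReal |w.2| * eLpNorm (Heis.weakDeriv Ω Heis.T f) s (volume.restrict Ω) +
        ENNReal.ofReal (‖w.1‖ ^ 2) *
          eLpNorm (fun p => ‖Heis.hHess Ω f p‖) s (volume.restrict Ω)) := by
  have hsub : volume.restrict A ≤ volume.restrict Ω := Measure.restrict_mono hAΩ le_rfl
  refine ⟨hf.vertical hn hΩ, fun w => ⟨?_, ?_⟩, fun w ε hε hεw => ?_⟩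
  · exact (((Heis.memLp_inner_hHess hΩ hf w.1).const_mul (1 / 2)).add
      ((hf.vertical hn hΩ).2.const_mul w.2)).mono_measure hsub
  · exact Heis.tendsto_diffQuot₂ hn hs1 hs hΩ hf hA hAΩ hdist w
  · exact Heis.memLp_diffQuot₂_and_eLpNorm_le hn hs1 hs hΩ hf hA hAΩ w hε hεw
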